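/- All rings are unitary and nontrivial, and $2$ is a non-zerodivisor in them. A \emph{superring} is a $\mathbb{Z}/2$-graded ring $R=R_{\bar 0}\oplus R_{\bar 1}$ with $xy=(-1)^{|x||y|}yx$ for homogeneous $x,y$; morphisms of superrings are parity-preserving ring homomorphisms; $R$ is \emph{Noetherian} if it satisfies the ascending chain condition on $\mathbb{Z}/2$-graded ideals. An $R$-\emph{supermodule} is a $\mathbb{Z}/2$-graded left $R$-module $M$ (with right action $m\cdot a=(-1)^{|a||m|}am$ on homogeneous elements); isomorphisms of supermodules are parity-preserving. A supermodule $M$ is \emph{invertible} if it is generated by finitely many homogeneous elements and, for every prime ideal $\mathfrak p$ of $R$ (that is, $R/\mathfrak p$ is an integral domain), $M_{\mathfrak p}\simeq R_{\mathfrak p}$ as $R_{\mathfrak p}$-supermodules, where localization is at the multiplicative set $R_{\bar 0}\setminus\mathfrak p$. Let $\mathbf{Pic}_+(R)$ be the set of isomorphism classes of invertible $R$-supermodules. Let $J_R=R\cdot R_{\bar 1}$, $\overline R=R/J_R$ (a purely even superring), and let $\pi_R:R\to\overline R$ be the projection; $R$ is \emph{split} if there is a morphism of superrings $\sigma:\overline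 R\to R$ with $\pi_R\circ\sigma=\mathrm{id}_{\overline R}$. \textbf{Proposition.} (1) For every Noetherian superring $R$, the operation $[M]\cdot[N]=[M\otimes_R N]$ is well defined on $\mathbf{Pic}_+(R)$ and makes it an abelian group with identity $[R]$. For every morphism $\varphi:R\to R'$ of Noetherian superrings, $[M]\mapsto[R'\otimes_R M]$ is a well-defined group homomorphism $\varphi_*:\mathbf{Pic}_+(R)\to\mathbf{Pic}_+(R')$, and in this way $\mathbf{Pic}_+$ is a covariant functor from Noetherian superrings to abelian groups. (2) If $R$ is a split Noetherian superring, then $\overline R$ is a Noetherian superring, the homomorphism $(\pi_R)_*:\mathbf{Pic}_+(R)\to\mathbf{Pic}_+(\overline R)$ is surjective, and $\mathbf{Pic}_+(R)$ splits as $$\mathbf{Pic}_+(R)\simeq\mathbf{Pic}_+(\overline R)\oplus\ker\big((\pi_R)_*\big),$$ by an isomorphism whose first component is $(\pi_R)_*$ and which sends each $k\in\ker((\pi_R)_*)$ to $(0,k)$. -/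

import Mathlib

open CategoryTheory

universe u

open scoped TensorProduct DirectSum

noncomputable section

lemma parity_cases (i : ZMod 2) : i = 0 ∨ i = 1 := by
  fin_cases i
  · exact Or.inl rfl
  · exact Or.inr rfl

/-- A `ZMod 2`-indexed family of additive subgroups is a direct sum decomposition as soon as there
is an additive projection onto the degree `0` part along the degree `1` part. -/
@[reducible] def parityDecomposition {M : Type*} [AddCommGroup M] (ℳ : ZMod 2 → AddSubgroup M)
    (p : M →+ M) (h0 : ∀ m, p m ∈ ℳ 0) (h1 : ∀ m, m - p m ∈ ℳ 1)
    (h00 : ∀ m ∈ ℳ 0, p m = m) (h10 : ∀ m ∈ ℳ 1, p m = 0) :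
    DirectSum.Decomposition ℳ where
  decompose' m := DirectSum.of (fun i => ℳ i) 0 ⟨p m, h0 m⟩ +
    DirectSum.of (fun i => ℳ i) 1 ⟨m - p m, h1 m⟩
  left_inv m := by simp
  right_inv x := by
    induction x using DirectSum.induction_on with
    | zero =>
      have e0 : (⟨p 0, h0 0⟩ : ℳ 0) = 0 := Subtype.ext (map_zero p)
      have e1 : (⟨0 - p 0, h1 0⟩ : ℳ 1) = 0 := Subtype.ext (by simp)
      rw [map_zero]
      beta_reduce
      rw [e0, e1, map_zero, map_zero, add_zero]
    | of i x =>
      obtain ⟨m, hm⟩ := x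
      rw [DirectSum.coeAddMonoidHom_of]
      dsimp only
      rcases parity_cases i with rfl | rfl
      · have e0 : (⟨p m, h0 m⟩ : ℳ 0) = ⟨m, hm⟩ := Subtype.ext (h00 m hm)
        have e1 : (⟨m - p m, h1 m⟩ : ℳ 1) = 0 := Subtype.ext (by simp [h00 m hm])
        rw [e0, e1, map_zero, add_zero]
      · have e0 : (⟨p m, h0 m⟩ : ℳ 0) = 0 := Subtype.ext (h10 m hm)
        have e1 : (⟨m - p m, h1 m⟩ : ℳ 1) = ⟨m, hm⟩ := Subtype.ext (by simp [h10 m hm])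
        rw [e0, e1, map_zero, zero_add]
    | add x y hx hy =>
      rw [← hx, ← hy]
      set a := DirectSum.coeAddMonoidHom ℳ x
      set b := DirectSum.coeAddMonoidHom ℳ y
      have e0 : (⟨p (a + b), h0 _⟩ : ℳ 0) = ⟨p a, h0 a⟩ + ⟨p b, h0 b⟩ :=
        Subtype.ext (map_add p a b)
      have e1 : (⟨a + b - p (a + b), h1 _⟩ : ℳ 1) = ⟨a - p a, h1 a⟩ + ⟨b - p b, h1 b⟩ :=
        Subtype.ext (by simp [add_sub_add_comm])
      have ea : DirectSum.coeAddMonoidHom ℳ (DirectSum.of (fun i => ℳ i) 0 ⟨p a, h0 a⟩ +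
          DirectSum.of (fun i => ℳ i) 1 ⟨a - p a, h1 a⟩) = a := by simp
      have eb : DirectSum.coeAddMonoidHom ℳ (DirectSum.of (fun i => ℳ i) 0 ⟨p b, h0 b⟩ +
          DirectSum.of (fun i => ℳ i) 1 ⟨b - p b, h1 b⟩) = b := by simp
      simp only [map_add _ (_ + _) (_ + _), ea, eb]
      rw [e0, e1, map_add, map_add]
      abel

/-- The even component, as an additive map. -/
def evenPart {M : Type*} [AddCommGroup M] (ℳ : ZMod 2 → AddSubgroup M)
    [DirectSum.Decomposition ℳ] : M →+ M :=
  AddMonoidHom.mk' (fun m => (DirectSum.decompose ℳ m 0 : M)) (by simp)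

section EvenPart

variable {M : Type*} [AddCommGroup M] (ℳ : ZMod 2 → AddSubgroup M) [DirectSum.Decomposition ℳ]

lemma evenPart_mem (m : M) : evenPart ℳ m ∈ ℳ 0 := (DirectSum.decompose ℳ m 0).2

lemma evenPart_of_even {m : M} (hm : m ∈ ℳ 0) : evenPart ℳ m = m :=
  DirectSum.decompose_of_mem_same ℳ hm

lemma evenPart_of_odd {m : M} (hm : m ∈ ℳ 1) : evenPart ℳ m = 0 :=
  DirectSum.decompose_of_mem_ne ℳ hm (by decide)

lemma sub_evenPart (m : M) : m - evenPart ℳ m = DirectSum.decompose ℳ m 1 := by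
  induction m using DirectSum.Decomposition.inductionOn ℳ with
  | zero => simp
  | @homogeneous i m =>
    obtain ⟨m, hm⟩ := m
    rcases parity_cases i with rfl | rfl
    · rw [evenPart_of_even ℳ hm, DirectSum.decompose_of_mem_ne ℳ hm (by decide), sub_self]
    · rw [evenPart_of_odd ℳ hm, DirectSum.decompose_of_mem_same ℳ hm, sub_zero]
  | add a b ha hb => simp [DirectSum.decompose_add, ← ha, ← hb, add_sub_add_comm]

lemma sub_evenPart_mem (m : M) : m - evenPart ℳ m ∈ ℳ 1 := by
  rw [sub_evenPart]; exact (DirectSum.decompose ℳ m 1).2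

end EvenPart

/-- A (supercommutative) superring: a nontrivial unitary ring `R = R₀ ⊕ R₁` graded by `ℤ/2` with
`x y = (-1)^{|x||y|} y x` for homogeneous `x, y`, in which `2` is a non-zerodivisor. -/
structure Superring : Type (u + 1) where
  carrier : Type u
  [ring : Ring carrier]
  grading : ZMod 2 → AddSubgroup carrier
  [gradedRing : GradedRing grading]
  [nontrivial : Nontrivial carrier]
  supercomm : ∀ (i j : ZMod 2) (x y : carrier), x ∈ grading i → y ∈ grading j →
    x * y = (-1) ^ (i.val * j.val) * (y * x)
  two_nonzerodivisor : ∀ x : carrier, 2 * x = 0 → x = 0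

namespace Superring

instance : CoeSort Superring.{u} (Type u) := ⟨Superring.carrier⟩

attribute [instance] Superring.ring Superring.gradedRing Superring.nontrivial

/-- Morphisms of superrings: ring homomorphisms preserving the parity. -/
structure Hom (R R' : Superring.{u}) : Type u where
  toRingHom : R →+* R'
  map_mem : ∀ (i : ZMod 2) (x : R), x ∈ R.grading i → toRingHom x ∈ R'.grading i

instance : Category Superring.{u} where
  Hom := Hom
  id R := ⟨RingHom.id R, fun _ _ h => h⟩
  comp f g := ⟨g.toRingHom.comp f.toRingHom, fun i x h => g.map_mem i _ (f.map_mem i x h)⟩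

/-- `R` is Noetherian: ascending chain condition on superideals (homogeneous ideals). -/
def IsNoetherian (R : Superring.{u}) : Prop :=
  WellFoundedGT (HomogeneousIdeal R.grading)

lemma even_comm (R : Superring.{u}) {x : R} (hx : x ∈ R.grading 0) (y : R) : x * y = y * x := by
  induction y using DirectSum.Decomposition.inductionOn R.grading with
  | zero => simp
  | @homogeneous i m => simpa using R.supercomm 0 i x m hx m.2
  | add a b ha hb => rw [mul_add, add_mul, ha, hb]

/-! ### Prime ideals and localization -/

/-- A prime ideal: a two-sided ideal whose quotient ring is an integral domain
(in particular commutative). -/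
def IsPrimeIdeal (R : Superring.{u}) (p : Ideal R) : Prop :=
  ∃ _ : p.IsTwoSided, IsDomain (R ⧸ p) ∧ ∀ x y : R ⧸ p, x * y = y * x

/-- The multiplicative set `R₀ - p₀` attached to a prime ideal `p`. -/
def primeCompl (R : Superring.{u}) (p : Ideal R) (hp : R.IsPrimeIdeal p) : Submonoid R where
  carrier := {x | x ∈ R.grading 0 ∧ x ∉ p}
  one_mem' := by
    refine ⟨SetLike.GradedOne.one_mem, fun h => ?_⟩
    obtain ⟨_, hd, _⟩ := hp
    exact one_ne_zero (α := R ⧸ p) (Ideal.Quotient.eq_zero_iff_mem.mpr h)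
  mul_mem' := by
    rintro a b ⟨ha, ha'⟩ ⟨hb, hb'⟩
    refine ⟨by simpa using SetLike.GradedMul.mul_mem ha hb, fun h => ?_⟩
    obtain ⟨_, hd, _⟩ := hp
    rw [← Ideal.Quotient.eq_zero_iff_mem, map_mul, mul_eq_zero] at h
    rcases h with h | h
    · exact ha' (Ideal.Quotient.eq_zero_iff_mem.mp h)
    · exact hb' (Ideal.Quotient.eq_zero_iff_mem.mp h)

/-- `R₀ - p₀` consists of central elements, so fractions with denominators in it exist. -/
instance (R : Superring.{u}) (p : Ideal R) (hp : R.IsPrimeIdeal p) :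
    OreLocalization.OreSet (R.primeCompl p hp) where
  ore_right_cancel r₁ r₂ s h := ⟨s, by
    rw [R.even_comm s.2.1 r₁, R.even_comm s.2.1 r₂, h]⟩
  oreNum r _ := r
  oreDenom _ s := s
  ore_eq r s := R.even_comm s.2.1 r

/-! ### The superreduced ring -/

/-- The canonical superideal `J_R = R · R₁`. -/
def canonicalIdeal (R : Superring.{u}) : Ideal R := Ideal.span (R.grading 1 : Set R)

lemma odd_mem_canonicalIdeal (R : Superring.{u}) {x : R} (hx : x ∈ R.grading 1) :
    x ∈ R.canonicalIdeal := Ideal.subset_span hx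

lemma sub_even_mem_canonicalIdeal (R : Superring.{u}) (x : R) :
    ∃ y ∈ R.grading 0, x - y ∈ R.canonicalIdeal := by
  induction x using DirectSum.Decomposition.inductionOn R.grading with
  | zero => exact ⟨0, zero_mem _, by simp⟩
  | @homogeneous i m =>
    obtain ⟨m, hm⟩ := m
    fin_cases i
    · exact ⟨m, hm, by simp⟩
    · exact ⟨0, zero_mem _, by simpa using R.odd_mem_canonicalIdeal hm⟩
  | add a b ha hb =>
    obtain ⟨a', ha', ha⟩ := ha
    obtain ⟨b', hb', hb⟩ := hb
    exact ⟨a' + b', add_mem ha' hb', by simpa [add_sub_add_comm] using add_mem ha hb⟩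

instance (R : Superring.{u}) : R.canonicalIdeal.IsTwoSided where
  mul_mem_of_left {a} b ha := by
    have odd : ∀ x ∈ R.grading 1, x * b ∈ R.canonicalIdeal := by
      intro x hx
      induction b using DirectSum.Decomposition.inductionOn R.grading with
      | zero => simp
      | @homogeneous i m =>
        rw [R.supercomm 1 i x m hx m.2, ← mul_assoc]
        exact Ideal.mul_mem_left _ _ (R.odd_mem_canonicalIdeal hx)
      | add c d hc hd => rw [mul_add]; exact add_mem hc hd
    induction ha using Submodule.span_induction with
    | mem x hx => exact odd x hx
    | zero => simp
    | add x y _ _ hx hy => rw [add_mul]; exact add_mem hx hy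
    | smul r x _ hx => rw [smul_eq_mul, mul_assoc]; exact Ideal.mul_mem_left _ _ hx

/-- `R` is split: the sequence `0 → J_R → R → R/J_R → 0` is split by a morphism of superrings
`σ : R/J_R → R` (where `R/J_R` is purely even). -/
def IsSplit (R : Superring.{u}) : Prop :=
  ∃ σ : (R ⧸ R.canonicalIdeal) →+* R, (∀ x, σ x ∈ R.grading 0) ∧
    ∀ x, Ideal.Quotient.mk R.canonicalIdeal (σ x) = x

/-- The grading of a purely even ring: everything in degree `0`, nothing in degree `1`. -/
def evenGrading (A : Type u) [Ring A] : ZMod 2 → AddSubgroup A := fun i => if i = 0 then ⊤ else ⊥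

instance (A : Type u) [Ring A] : GradedRing (evenGrading A) where
  one_mem := by simp [evenGrading]
  mul_mem := by
    intro i j x y hx hy
    rcases parity_cases i with rfl | rfl <;> rcases parity_cases j with rfl | rfl <;>
      simp_all [evenGrading]
  toDecomposition := parityDecomposition _ (AddMonoidHom.id A)
    (by simp [evenGrading]) (by simp [evenGrading]) (by simp) (by simp [evenGrading])

/-- The superreduced `R̄ = R/J_R` of a split superring `R`, a (purely even) superring.
Splitness is used only to see that `R̄` is nontrivial and that `2` is a non-zerodivisor in it. -/
abbrev superreduced (R : Superring.{u}) (h : R.IsSplit) : Superring.{u} where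
  carrier := R ⧸ R.canonicalIdeal
  ring := Ideal.Quotient.ring R.canonicalIdeal
  grading := evenGrading (R ⧸ R.canonicalIdeal)
  nontrivial := by
    obtain ⟨σ, -, -⟩ := h
    exact σ.domain_nontrivial
  supercomm := by
    have key : ∀ x y : R ⧸ R.canonicalIdeal, x * y = y * x := by
      intro x y
      obtain ⟨a, rfl⟩ := Ideal.Quotient.mk_surjective x
      obtain ⟨b, rfl⟩ := Ideal.Quotient.mk_surjective y
      obtain ⟨a', ha', haa⟩ := R.sub_even_mem_canonicalIdeal a
      rw [Ideal.Quotient.eq.mpr haa, ← map_mul, ← map_mul, R.even_comm ha']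
    intro i j x y hx hy
    rcases parity_cases i with rfl | rfl <;> rcases parity_cases j with rfl | rfl <;>
      simp_all [evenGrading]
  two_nonzerodivisor := by
    obtain ⟨σ, -, hσ⟩ := h
    intro x hx
    have : σ x = 0 := R.two_nonzerodivisor _ (by rw [← map_ofNat σ 2, ← map_mul, hx, map_zero])
    rw [← hσ x, this, map_zero]

/-- The projection `π_R : R → R̄`. -/
def toSuperreduced (R : Superring.{u}) (h : R.IsSplit) : R ⟶ R.superreduced h where
  toRingHom := Ideal.Quotient.mk R.canonicalIdeal
  map_mem := by
    intro i x hx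
    fin_cases i
    · exact AddSubgroup.mem_top _
    · exact AddSubgroup.mem_bot.mpr
        (Ideal.Quotient.eq_zero_iff_mem.mpr (R.odd_mem_canonicalIdeal hx))

lemma superreduced_isNoetherian (R : Superring.{u}) (h : R.IsSplit) (hN : R.IsNoetherian) :
    (R.superreduced h).IsNoetherian := by
  have : WellFoundedGT (HomogeneousIdeal R.grading) := hN
  let π : R →+* R ⧸ R.canonicalIdeal := Ideal.Quotient.mk R.canonicalIdeal
  have hπ : Function.Surjective π := Ideal.Quotient.mk_surjective
  have hom : ∀ I : Ideal (R ⧸ R.canonicalIdeal), (I.comap π).IsHomogeneous R.grading := by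
    intro I i x hx
    have hodd : ∀ y ∈ R.grading 1, π y = 0 := fun y hy =>
      Ideal.Quotient.eq_zero_iff_mem.mpr (R.odd_mem_canonicalIdeal hy)
    have hsum : evenPart R.grading x + DirectSum.decompose R.grading x 1 = x := by
      rw [← sub_evenPart, add_sub_cancel]
    have h1 := hodd _ (DirectSum.decompose R.grading x 1).2
    rw [Ideal.mem_comap] at hx ⊢
    rw [← hsum, map_add, h1, add_zero] at hx
    fin_cases i
    · exact hx
    · change π (DirectSum.decompose R.grading x 1 : R) ∈ I
      rw [h1]; exact I.zero_mem
  let f : HomogeneousIdeal (R.superreduced h).grading → HomogeneousIdeal R.grading := fun I =>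
    ⟨Ideal.comap π I.toIdeal, hom _⟩
  have hf : StrictMono f := by
    intro I I' hI
    refine lt_of_le_of_ne (fun x hx => hI.le hx) fun he => hI.ne ?_
    have : Ideal.comap π I.toIdeal = Ideal.comap π I'.toIdeal :=
      congrArg HomogeneousIdeal.toIdeal he
    exact HomogeneousIdeal.toIdeal_injective (Ideal.comap_injective_of_surjective π hπ this)
  exact hf.wellFoundedGT

end Superring

/-! ### Supermodules -/

/-- A supermodule over a superring `R`: a left `R`-module `M = M₀ ⊕ M₁` with `Rᵢ Mⱼ ⊆ Mᵢ₊ⱼ`. -/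
structure Supermodule (R : Superring.{u}) : Type (u + 1) where
  carrier : Type u
  [addCommGroup : AddCommGroup carrier]
  [module : Module R carrier]
  grading : ZMod 2 → AddSubgroup carrier
  [decomposition : DirectSum.Decomposition grading]
  [gradedSMul : SetLike.GradedSMul R.grading grading]

namespace Supermodule

instance (R : Superring.{u}) : CoeSort (Supermodule R) (Type u) := ⟨Supermodule.carrier⟩

attribute [instance] Supermodule.addCommGroup Supermodule.module Supermodule.decomposition
  Supermodule.gradedSMul

/-- `R` as a supermodule over itself. -/
abbrev unit (R : Superring.{u}) : Supermodule R where
  carrier := R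
  grading := R.grading

/-- `M ≃ N`: there is a bijective `R`-linear map preserving the parity. -/
def Isomorphic {R : Superring.{u}} (M N : Supermodule R) : Prop :=
  ∃ f : M ≃ₗ[R] N, ∀ (i : ZMod 2) (x : M), x ∈ M.grading i → f x ∈ N.grading i

lemma Isomorphic.refl {R : Superring.{u}} (M : Supermodule R) : Isomorphic M M :=
  ⟨LinearEquiv.refl R M, fun _ _ h => h⟩

lemma Isomorphic.trans {R : Superring.{u}} {M N P : Supermodule R} :
    Isomorphic M N → Isomorphic N P → Isomorphic M P := fun ⟨f, hf⟩ ⟨g, hg⟩ =>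
  ⟨f.trans g, fun i x h => hg i _ (hf i x h)⟩

lemma Isomorphic.symm {R : Superring.{u}} {M N : Supermodule R} : Isomorphic M N → Isomorphic N M := by
  rintro ⟨f, hf⟩
  have key : ∀ (x : M) (i : ZMod 2),
      f (DirectSum.decompose M.grading x i) = DirectSum.decompose N.grading (f x) i := by
    intro x i
    induction x using DirectSum.Decomposition.inductionOn M.grading with
    | zero => simp
    | @homogeneous j m =>
      by_cases hij : j = i
      · subst hij
        rw [DirectSum.decompose_of_mem_same _ m.2,
          DirectSum.decompose_of_mem_same _ (hf j m m.2)]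
      · rw [DirectSum.decompose_of_mem_ne _ m.2 hij,
          DirectSum.decompose_of_mem_ne _ (hf j m m.2) hij, map_zero]
    | add a b ha hb => simp [DirectSum.decompose_add, ha, hb]
  refine ⟨f.symm, fun i y hy => ?_⟩
  have h := key (f.symm y) i
  rw [f.apply_symm_apply, DirectSum.decompose_of_mem_same _ hy] at h
  rw [← h, f.symm_apply_apply]
  exact (DirectSum.decompose M.grading (f.symm y) i).2

/-- The localization `M_p`, a left module over the localization `R_p`. -/
abbrev LocalizationAt {R : Superring.{u}} (M : Supermodule R) (p : Ideal R)
    (hp : R.IsPrimeIdeal p) : Type u :=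
  OreLocalization (R.primeCompl p hp) M

/-- The degree `i` part of `M_p`: fractions `m / s` with `m ∈ Mᵢ` and `s ∈ R₀ - p₀`. -/
def localizationGrading {R : Superring.{u}} (M : Supermodule R) (p : Ideal R)
    (hp : R.IsPrimeIdeal p) (i : ZMod 2) : Set (M.LocalizationAt p hp) :=
  {x | ∃ m ∈ M.grading i, ∃ s : R.primeCompl p hp, x = OreLocalization.oreDiv m s}

/-- `M` is invertible: `M` is generated by finitely many homogeneous elements and `M_p ≃ R_p` as
`R_p`-supermodules for every prime ideal `p` of `R`. -/
def IsInvertible {R : Superring.{u}} (M : Supermodule R) : Prop :=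
  (∃ s : Finset M, (∀ m ∈ s, ∃ i, m ∈ M.grading i) ∧ Submodule.span R (s : Set M) = ⊤) ∧
  ∀ (p : Ideal R) (hp : R.IsPrimeIdeal p),
    ∃ f : M.LocalizationAt p hp
        ≃ₗ[OreLocalization (R.primeCompl p hp) R] (unit R).LocalizationAt p hp,
      ∀ (i : ZMod 2), ∀ x ∈ M.localizationGrading p hp i,
        f x ∈ (unit R).localizationGrading p hp i

/-! ### Tensor products -/

section Tensor

variable {R R' : Superring.{u}} (φ : R ⟶ R') (N : Supermodule R') (M : Supermodule R)

/-- The relations `(n · r) ⊗ m - n ⊗ (r m)` on homogeneous elements, where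
`n · r = (-1)^{|n||r|} φ(r) n` is the right action of `R` on `N`. -/
def tensorRelations : Set (N ⊗[ℤ] M) :=
  {t | ∃ (i j k : ZMod 2), ∃ n ∈ N.grading i, ∃ r ∈ R.grading j, ∃ m ∈ M.grading k,
    t = (((-1 : ℤ) ^ (i.val * j.val)) • (φ.toRingHom r • n)) ⊗ₜ[ℤ] m - n ⊗ₜ[ℤ] (r • m)}

/-- The underlying `R'`-module of `N ⊗_R M`, with `R'` acting on the left factor. -/
abbrev TensorCarrier : Type u :=
  (N ⊗[ℤ] M) ⧸ Submodule.span R' (tensorRelations φ N M)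

/-- The class of `n ⊗ m` in `N ⊗_R M`. -/
abbrev tensorMk (n : N) (m : M) : TensorCarrier φ N M :=
  Submodule.Quotient.mk (n ⊗ₜ[ℤ] m)

/-- The degree `k` part of `N ⊗_R M`, spanned by the `n ⊗ m` with `|n| + |m| = k`. -/
def tensorGrading (k : ZMod 2) : AddSubgroup (TensorCarrier φ N M) :=
  AddSubgroup.closure {t | ∃ (i j : ZMod 2), i + j = k ∧
    ∃ n ∈ N.grading i, ∃ m ∈ M.grading j, t = tensorMk φ N M n m}

lemma tensorMk_mem {i j k : ZMod 2} (hk : i + j = k) {n : N} (hn : n ∈ N.grading i) {m : M}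
    (hm : m ∈ M.grading j) : tensorMk φ N M n m ∈ tensorGrading φ N M k :=
  AddSubgroup.subset_closure ⟨i, j, hk, n, hn, m, hm, rfl⟩

/-- The even component on `N ⊗_ℤ M`. -/
def tensorEvenAux : N ⊗[ℤ] M →ₗ[ℤ] N ⊗[ℤ] M :=
  TensorProduct.map (evenPart N.grading).toIntLinearMap (evenPart M.grading).toIntLinearMap +
    TensorProduct.map (AddMonoidHom.id N - evenPart N.grading).toIntLinearMap
      (AddMonoidHom.id M - evenPart M.grading).toIntLinearMap

lemma tensorEvenAux_tmul (n : N) (m : M) :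
    tensorEvenAux N M (n ⊗ₜ[ℤ] m) = evenPart N.grading n ⊗ₜ[ℤ] evenPart M.grading m +
      (n - evenPart N.grading n) ⊗ₜ[ℤ] (m - evenPart M.grading m) := rfl

lemma tensorEvenAux_even {i j : ZMod 2} (h : i + j = 0) {n : N} (hn : n ∈ N.grading i) {m : M}
    (hm : m ∈ M.grading j) : tensorEvenAux N M (n ⊗ₜ[ℤ] m) = n ⊗ₜ[ℤ] m := by
  rw [tensorEvenAux_tmul]
  rcases parity_cases i with rfl | rfl <;> rcases parity_cases j with rfl | rfl
  · simp [evenPart_of_even _ hn, evenPart_of_even _ hm]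
  · exact absurd h (by decide)
  · exact absurd h (by decide)
  · simp [evenPart_of_odd _ hn, evenPart_of_odd _ hm]

lemma tensorEvenAux_odd {i j : ZMod 2} (h : i + j = 1) {n : N} (hn : n ∈ N.grading i) {m : M}
    (hm : m ∈ M.grading j) : tensorEvenAux N M (n ⊗ₜ[ℤ] m) = 0 := by
  rw [tensorEvenAux_tmul]
  rcases parity_cases i with rfl | rfl <;> rcases parity_cases j with rfl | rfl
  · exact absurd h (by decide)
  · simp [evenPart_of_even _ hn, evenPart_of_odd _ hm]
  · simp [evenPart_of_odd _ hn, evenPart_of_even _ hm]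
  · exact absurd h (by decide)

lemma tensorEvenAux_smul (r : R') (t : N ⊗[ℤ] M) :
    tensorEvenAux N M (r • t) = evenPart R'.grading r • tensorEvenAux N M t +
      (r - evenPart R'.grading r) • (t - tensorEvenAux N M t) := by
  induction t using TensorProduct.induction_on with
  | zero => simp
  | add x y hx hy =>
    rw [smul_add, map_add, hx, hy, map_add, smul_add, add_sub_add_comm, smul_add]
    abel
  | tmul n m =>
    induction n using DirectSum.Decomposition.inductionOn N.grading with
    | zero => simp
    | add a b ha hb =>
      rw [TensorProduct.add_tmul, smul_add, map_add, ha, hb, map_add, smul_add, add_sub_add_comm,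
        smul_add]
      abel
    | @homogeneous i n =>
      induction m using DirectSum.Decomposition.inductionOn M.grading with
      | zero => simp
      | add a b ha hb =>
        rw [TensorProduct.tmul_add, smul_add, map_add, ha, hb, map_add, smul_add,
          add_sub_add_comm, smul_add]
        abel
      | @homogeneous j m =>
        have he : evenPart R'.grading r • (n : N) ∈ N.grading (0 + i) :=
          SetLike.GradedSMul.smul_mem (evenPart_mem _ r) n.2
        have ho : (r - evenPart R'.grading r) • (n : N) ∈ N.grading (1 + i) :=
          SetLike.GradedSMul.smul_mem (sub_evenPart_mem _ r) n.2
        have hr : r • ((n : N) ⊗ₜ[ℤ] (m : M)) =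
            (evenPart R'.grading r • (n : N)) ⊗ₜ[ℤ] (m : M) +
              ((r - evenPart R'.grading r) • (n : N)) ⊗ₜ[ℤ] (m : M) := by
          rw [← TensorProduct.add_tmul, ← add_smul, add_sub_cancel, TensorProduct.smul_tmul']
        rw [hr, map_add]
        rcases parity_cases (i + j) with h | h
        · rw [tensorEvenAux_even N M (by rw [zero_add, h]) he m.2,
            tensorEvenAux_odd N M (by rw [add_assoc, h]; rfl) ho m.2,
            tensorEvenAux_even N M h n.2 m.2, sub_self, smul_zero, TensorProduct.smul_tmul']
        · rw [tensorEvenAux_odd N M (by rw [zero_add, h]) he m.2,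
            tensorEvenAux_even N M (by rw [add_assoc, h]; rfl) ho m.2,
            tensorEvenAux_odd N M h n.2 m.2, sub_zero, smul_zero, TensorProduct.smul_tmul']

lemma tensorEvenAux_mem {t : N ⊗[ℤ] M} (ht : t ∈ Submodule.span R' (tensorRelations φ N M)) :
    tensorEvenAux N M t ∈ Submodule.span R' (tensorRelations φ N M) := by
  induction ht using Submodule.span_induction with
  | zero => simp
  | add x y _ _ hx hy => rw [map_add]; exact add_mem hx hy
  | smul r x hx' hx =>
    rw [tensorEvenAux_smul]
    exact add_mem (Submodule.smul_mem _ _ hx) (Submodule.smul_mem _ _ (sub_mem hx' hx))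
  | mem x hx =>
    have hx' := hx
    obtain ⟨i, j, k, n, hn, r, hr, m, hm, rfl⟩ := hx
    have h1 : ((-1 : ℤ) ^ (i.val * j.val)) • (φ.toRingHom r • n) ∈ N.grading (j + i) :=
      zsmul_mem (SetLike.GradedSMul.smul_mem (φ.map_mem j r hr) hn) _
    have h2 : r • m ∈ M.grading (j + k) := SetLike.GradedSMul.smul_mem hr hm
    rw [map_sub]
    rcases parity_cases (j + i + k) with h | h
    · rw [tensorEvenAux_even N M h h1 hm,
        tensorEvenAux_even N M (by rw [← h]; ring) hn h2]
      exact Submodule.subset_span hx'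
    · rw [tensorEvenAux_odd N M h h1 hm,
        tensorEvenAux_odd N M (by rw [← h]; ring) hn h2, sub_self]
      exact zero_mem _

/-- The even component on `N ⊗_R M`. -/
def tensorEven : TensorCarrier φ N M →+ TensorCarrier φ N M :=
  ((((Submodule.span R' (tensorRelations φ N M)).restrictScalars ℤ).liftQ
    (((Submodule.span R' (tensorRelations φ N M)).mkQ.restrictScalars ℤ).comp
      (tensorEvenAux N M))
    (fun t ht => by
      simpa using tensorEvenAux_mem φ N M ht)).comp
    (Submodule.Quotient.restrictScalarsEquiv ℤ
      (Submodule.span R' (tensorRelations φ N M))).symm.toLinearMap).toAddMonoidHom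

lemma tensorEven_mk (t : N ⊗[ℤ] M) :
    tensorEven φ N M (Submodule.Quotient.mk t) = Submodule.Quotient.mk (tensorEvenAux N M t) := rfl

lemma tensorEven_mem_and (t : TensorCarrier φ N M) :
    tensorEven φ N M t ∈ tensorGrading φ N M 0 ∧
      t - tensorEven φ N M t ∈ tensorGrading φ N M 1 := by
  obtain ⟨t, rfl⟩ := Submodule.Quotient.mk_surjective _ t
  rw [tensorEven_mk, ← Submodule.Quotient.mk_sub]
  induction t using TensorProduct.induction_on with
  | zero => simp
  | add x y hx hy =>
    rw [map_add, add_sub_add_comm, Submodule.Quotient.mk_add, Submodule.Quotient.mk_add]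
    exact ⟨add_mem hx.1 hy.1, add_mem hx.2 hy.2⟩
  | tmul n m =>
    have n0 := evenPart_mem N.grading n
    have n1 := sub_evenPart_mem N.grading n
    have m0 := evenPart_mem M.grading m
    have m1 := sub_evenPart_mem M.grading m
    have hd : n ⊗ₜ[ℤ] m - tensorEvenAux N M (n ⊗ₜ[ℤ] m) =
        evenPart N.grading n ⊗ₜ[ℤ] (m - evenPart M.grading m) +
          (n - evenPart N.grading n) ⊗ₜ[ℤ] evenPart M.grading m := by
      rw [tensorEvenAux_tmul]
      simp only [TensorProduct.sub_tmul, TensorProduct.tmul_sub]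
      abel
    rw [hd, tensorEvenAux_tmul, Submodule.Quotient.mk_add, Submodule.Quotient.mk_add]
    exact ⟨add_mem (tensorMk_mem φ N M (by decide) n0 m0) (tensorMk_mem φ N M (by decide) n1 m1),
      add_mem (tensorMk_mem φ N M (by decide) n0 m1) (tensorMk_mem φ N M (by decide) n1 m0)⟩

/-- For a morphism `φ : R → R'`, an `R'`-supermodule `N` and an `R`-supermodule `M`, the
`R'`-supermodule `N ⊗_R M`, where `R` acts on `N` through `φ`. -/
abbrev tensorAlong : Supermodule R' where
  carrier := TensorCarrier φ N M
  grading := tensorGrading φ N M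
  decomposition := parityDecomposition _ (tensorEven φ N M)
    (fun t => (tensorEven_mem_and φ N M t).1) (fun t => (tensorEven_mem_and φ N M t).2)
    (fun t ht => by
      induction ht using AddSubgroup.closure_induction with
      | zero => simp
      | add x y _ _ hx hy => rw [map_add, hx, hy]
      | neg x _ hx => rw [map_neg, hx]
      | mem x hx =>
        obtain ⟨i, j, hij, n, hn, m, hm, rfl⟩ := hx
        rw [tensorMk, tensorEven_mk, tensorEvenAux_even N M hij hn hm])
    (fun t ht => by
      induction ht using AddSubgroup.closure_induction with
      | zero => simp
      | add x y _ _ hx hy => rw [map_add, hx, hy, add_zero]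
      | neg x _ hx => rw [map_neg, hx, neg_zero]
      | mem x hx =>
        obtain ⟨i, j, hij, n, hn, m, hm, rfl⟩ := hx
        rw [tensorMk, tensorEven_mk, tensorEvenAux_odd N M hij hn hm]
        rfl)
  gradedSMul := ⟨by
    intro i k r t hr ht
    rw [vadd_eq_add]
    induction ht using AddSubgroup.closure_induction with
    | zero => simp
    | add x y _ _ hx hy => rw [smul_add]; exact add_mem hx hy
    | neg x _ hx => rw [smul_neg]; exact neg_mem hx
    | mem x hx =>
      obtain ⟨a, b, hab, n, hn, m, hm, rfl⟩ := hx
      have : r • tensorMk φ N M n m = tensorMk φ N M (r • n) m := rfl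
      rw [this]
      exact tensorMk_mem φ N M ((add_assoc i a b).trans (congrArg (i + ·) hab))
        (SetLike.GradedSMul.smul_mem hr hn : r • n ∈ N.grading (i + a)) hm⟩

end Tensor

/-- The tensor product `M ⊗_R N` of two `R`-supermodules. -/
abbrev tensor {R : Superring.{u}} (M N : Supermodule R) : Supermodule R := tensorAlong (𝟙 R) M N

/-- Extension of scalars `R' ⊗_R M` along a morphism `φ : R → R'`. -/
abbrev baseChange {R R' : Superring.{u}} (φ : R ⟶ R') (M : Supermodule R) : Supermodule R' :=
  tensorAlong φ (unit R') M

/-- Isomorphism of invertible supermodules, as an equivalence relation. -/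
def invertibleSetoid (R : Superring.{u}) : Setoid {M : Supermodule R // M.IsInvertible} where
  r M N := Isomorphic M.1 N.1
  iseqv := ⟨fun M => .refl M.1, fun h => h.symm, fun h h' => h.trans h'⟩

end Supermodule

/-- The set `Pic₊(R)` of isomorphism classes of invertible `R`-supermodules. -/
def PicPlus (R : Superring.{u}) : Type (u + 1) := Quotient (Supermodule.invertibleSetoid R)

/-- The class `[M]` of an invertible supermodule `M`. -/
def PicPlus.mk {R : Superring.{u}} (M : Supermodule R) (hM : M.IsInvertible) : PicPlus R :=
  Quotient.mk (Supermodule.invertibleSetoid R) ⟨M, hM⟩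

/-! ### The category of Noetherian superrings -/

/-- A Noetherian superring. -/
structure NoetherianSuperring : Type (u + 1) where
  toSuperring : Superring.{u}
  isNoetherian : toSuperring.IsNoetherian

namespace NoetherianSuperring

/-- Noetherian superrings form a full subcategory of superrings. -/
instance : Category NoetherianSuperring.{u} where
  Hom R R' := R.toSuperring ⟶ R'.toSuperring
  id R := 𝟙 R.toSuperring
  comp f g := Superring.instCategory.comp f g

/-- The superreduced `R̄` of a split Noetherian superring `R`. -/
abbrev superreduced (R : NoetherianSuperring.{u}) (h : R.toSuperring.IsSplit) :
    NoetherianSuperring.{u} :=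
  ⟨R.toSuperring.superreduced h, R.toSuperring.superreduced_isNoetherian h R.isNoetherian⟩

/-- The projection `π_R : R → R̄`. -/
def proj (R : NoetherianSuperring.{u}) (h : R.toSuperring.IsSplit) : R ⟶ R.superreduced h :=
  R.toSuperring.toSuperreduced h

end NoetherianSuperring

end

/-! The proof identifies Pic₊(R) with the ordinary Picard group of the commutative ring R₀ by `M ↦
M₀`, and transports everything from there.

Since 2 is a non-zerodivisor, odd elements square to zero, so a product of two odd elements has
square zero and lies in every prime of R₀. Hence the primes of R₀ are exactly the contractions of
the primes of R (`evenQuotientMk`, `IsPrimeIdeal.comap_isPrime`). The local condition on M therefore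
says that, locally over Spec R₀, M is free on one even generator (`hasLocalGenerators_iff`). This
makes R ⊗_{R₀} M₀ → M bijective and, as R₀ is Noetherian and M finite, makes M₀ an invertible
R₀-module. Conversely, every module induced from an invertible R₀-module is invertible
(`isInvertible_iff`).

For induced modules, N ⊗_R M is R' ⊗_{R'₀} (N₀ ⊗_{R₀} M₀) (`tensorAlong_isInducedInvertible`).
Taking φ = id gives the product, and N = R' gives base change along R₀ → R'₀. The group laws and
functoriality are thus those of `CommRing.Pic`. If R is split, σ is a section of π_R as a morphism
of superrings, so functoriality yields a section of (π_R)_*, which splits off the kernel. -/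

/-! ### The even part of a superring and products of odd elements -/

namespace Superring

/-- The even part `R₀` of a superring, as a subring. -/
def evenSubring (R : Superring.{u}) : Subring R where
  carrier := R.grading 0
  mul_mem' ha hb := by simpa using SetLike.GradedMul.mul_mem ha hb
  one_mem' := SetLike.GradedOne.one_mem
  add_mem' := add_mem
  zero_mem' := zero_mem _
  neg_mem' := neg_mem

instance (R : Superring.{u}) : CommRing R.evenSubring where
  mul_comm a b := Subtype.ext (R.even_comm a.2 b)

instance (R : Superring.{u}) : Algebra R.evenSubring R where
  algebraMap := R.evenSubring.subtype
  commutes' a x := R.even_comm a.2 x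
  smul_def' _ _ := rfl

/-- Supercommutativity gives only 2x² = 0; this is where 2 must be a non-zerodivisor. -/
lemma odd_mul_self {R : Superring.{u}} {x : R} (hx : x ∈ R.grading 1) : x * x = 0 := by
  have h := R.supercomm 1 1 x x hx hx
  refine R.two_nonzerodivisor _ ?_
  rw [ZMod.val_one, mul_one, pow_one, neg_one_mul, eq_neg_iff_add_eq_zero] at h
  rw [two_mul, h]

lemma odd_mul_odd {R : Superring.{u}} {x y : R} (hx : x ∈ R.grading 1) (hy : y ∈ R.grading 1) :
    x * y ∈ R.grading 0 := by
  have := SetLike.GradedMul.mul_mem hx hy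
  rwa [show (1 : ZMod 2) + 1 = 0 by decide] at this

lemma odd_mul_odd_sq {R : Superring.{u}} {x y : R} (hx : x ∈ R.grading 1) (hy : y ∈ R.grading 1) :
    (x * y) * (x * y) = 0 := by
  rw [mul_assoc, ← mul_assoc y x y, R.supercomm 1 1 y x hy hx]
  simp [mul_assoc, odd_mul_self hy]

end Superring

/-! ### The even part of a supermodule -/

namespace Supermodule

variable {R : Superring.{u}} (M : Supermodule R)

lemma smul_mem_grading {i j : ZMod 2} {r : R} {m : M} (hr : r ∈ R.grading i)
    (hm : m ∈ M.grading j) : r • m ∈ M.grading (i + j) :=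
  SetLike.GradedSMul.smul_mem hr hm

/-- The even part `M₀` of a supermodule, as a module over the even part of the superring. -/
def evenSubmodule : Submodule R.evenSubring M where
  carrier := M.grading 0
  add_mem' := add_mem
  zero_mem' := zero_mem _
  smul_mem' a m hm := by
    have h := M.smul_mem_grading (i := 0) (j := 0) a.2 hm
    rwa [add_zero] at h

lemma evenPart_smul_of_even (r : R) {m : M} (hm : m ∈ M.grading 0) :
    evenPart M.grading (r • m) = evenPart R.grading r • m := by
  conv_lhs => rw [← add_sub_cancel (evenPart R.grading r) r, add_smul, map_add]
  have he := M.smul_mem_grading (evenPart_mem R.grading r) hm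
  have ho := M.smul_mem_grading (sub_evenPart_mem R.grading r) hm
  rw [add_zero] at he ho
  rw [evenPart_of_even _ he, evenPart_of_odd _ ho, add_zero]

lemma evenPart_even_smul {r : R} (hr : r ∈ R.grading 0) (m : M) :
    evenPart M.grading (r • m) = r • evenPart M.grading m := by
  conv_lhs => rw [← add_sub_cancel (evenPart M.grading m) m, smul_add, map_add]
  have he := M.smul_mem_grading hr (evenPart_mem M.grading m)
  have ho := M.smul_mem_grading hr (sub_evenPart_mem M.grading m)
  rw [zero_add] at he ho
  rw [evenPart_of_even _ he, evenPart_of_odd _ ho, add_zero]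

/-- The projection of a supermodule onto its even part. -/
def evenProj : M →ₗ[R.evenSubring] M.evenSubmodule where
  toFun m := ⟨evenPart M.grading m, evenPart_mem _ m⟩
  map_add' _ _ := Subtype.ext (map_add _ _ _)
  map_smul' a m := Subtype.ext (M.evenPart_even_smul a.2 m)

lemma evenProj_apply (m : M.evenSubmodule) : M.evenProj m = m :=
  Subtype.ext (evenPart_of_even _ m.2)

/-- The multiplication map `R ⊗ M₀ → M`. -/
def evenMul : R ⊗[R.evenSubring] M.evenSubmodule →ₗ[R] M :=
  TensorProduct.AlgebraTensorModule.lift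
    { toFun := fun r =>
        { toFun := fun m => r • (m : M)
          map_add' := fun x y => smul_add r (x : M) y
          map_smul' := fun a x => by
            change r • (a : R) • (x : M) = (a : R) • r • (x : M)
            rw [smul_smul, smul_smul, R.even_comm a.2] }
      map_add' := fun r s => by ext; exact add_smul r s _
      map_smul' := fun r s => by ext; exact mul_smul r s _ }

@[simp] lemma evenMul_tmul (r : R) (m : M.evenSubmodule) : M.evenMul (r ⊗ₜ m) = r • (m : M) := rfl

/-- `M` is induced from an invertible module over the even part of `R`. -/
structure IsInducedInvertible : Prop where
  invertible : Module.Invertible R.evenSubring M.evenSubmodule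
  bijective : Function.Bijective M.evenMul

/-- `M` is locally, over the spectrum of the even part of `R`, free on one even generator. -/
def HasLocalGenerators : Prop :=
  ∀ p : Ideal R.evenSubring, p.IsPrime → ∃ m : M.evenSubmodule,
    (∀ x : M, ∃ t : R.evenSubring, t ∉ p ∧ ∃ r : R, t • x = r • (m : M)) ∧
    ∀ r : R, r • (m : M) = 0 → ∃ t : R.evenSubring, t ∉ p ∧ t • r = 0

end Supermodule

/-! ### Ideals and primes of the even part -/

namespace Superring

lemma evenPart_mul_of_even {R : Superring.{u}} (r : R) {a : R} (ha : a ∈ R.grading 0) :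
    evenPart R.grading (r * a) = evenPart R.grading r * a :=
  (Supermodule.unit R).evenPart_smul_of_even r ha

/-- The even part of a product. -/
lemma evenPart_mul {R : Superring.{u}} (x y : R) :
    evenPart R.grading (x * y) = evenPart R.grading x * evenPart R.grading y +
      (x - evenPart R.grading x) * (y - evenPart R.grading y) := by
  have hx := sub_evenPart_mem R.grading x
  have hy := sub_evenPart_mem R.grading y
  have hy0 := evenPart_mem R.grading y
  have h1 := SetLike.GradedMul.mul_mem hx hy0
  rw [add_zero] at h1
  have h2 := SetLike.GradedMul.mul_mem (evenPart_mem R.grading x) hy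
  rw [zero_add] at h2
  have h : x * y = evenPart R.grading x * evenPart R.grading y +
      (x - evenPart R.grading x) * evenPart R.grading y +
      evenPart R.grading x * (y - evenPart R.grading y) +
      (x - evenPart R.grading x) * (y - evenPart R.grading y) := by
    noncomm_ring
  conv_lhs => rw [h]
  rw [map_add, map_add, map_add, evenPart_of_even _ (odd_mul_odd hx hy), evenPart_of_odd _ h2,
    evenPart_of_odd _ h1, add_zero, add_zero,
    evenPart_of_even _ (R.evenSubring.mul_mem (evenPart_mem R.grading x) hy0)]

/-- Extension I ↦ R·I embeds the ideals of R₀ into the homogeneous ideals of R: contracting back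
recovers I, because the even part of r·x with x ∈ I is r₀·x. -/
lemma evenSubring_isNoetherianRing {R : Superring.{u}} (hR : R.IsNoetherian) :
    IsNoetherianRing R.evenSubring := by
  have : WellFoundedGT (HomogeneousIdeal R.grading) := hR
  let f : Ideal R.evenSubring → HomogeneousIdeal R.grading := fun I =>
    ⟨Ideal.span (Subtype.val '' (I : Set R.evenSubring)), Ideal.homogeneous_span _ _ (by
      rintro _ ⟨x, -, rfl⟩; exact ⟨0, x.2⟩)⟩
  have key : ∀ (I : Ideal R.evenSubring) (a : R.evenSubring), (a : R) ∈ f I ↔ a ∈ I := by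
    refine fun I a => ⟨fun h => ?_, fun h => Ideal.subset_span ⟨a, h, rfl⟩⟩
    -- Quantifying over the multiplier r lets the induction absorb left multiplication.
    have aux : ∀ x : R, x ∈ Ideal.span (Subtype.val '' (I : Set R.evenSubring)) → ∀ r : R,
        (⟨evenPart R.grading (r * x), evenPart_mem _ _⟩ : R.evenSubring) ∈ I := by
      intro x hx
      induction hx using Submodule.span_induction with
      | zero =>
        intro r
        convert I.zero_mem
        exact Subtype.ext (by simp)
      | mem x hx =>
        obtain ⟨x, hx, rfl⟩ := hx
        intro r
        convert I.mul_mem_left ⟨evenPart R.grading r, evenPart_mem _ _⟩ hx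
        exact Subtype.ext (evenPart_mul_of_even r x.2)
      | add x y _ _ hx hy =>
        intro r
        convert I.add_mem (hx r) (hy r)
        exact Subtype.ext (by simp [mul_add])
      | smul s x _ hx =>
        intro r
        convert hx (r * s) using 3
        rw [smul_eq_mul, mul_assoc]
    have ha : evenPart R.grading (1 * a) = a := by rw [one_mul, evenPart_of_even _ a.2]
    exact (congrArg (· ∈ I) (Subtype.ext ha)).mp (aux a h 1)
  have hf : StrictMono f := by
    refine Monotone.strictMono_of_injective (fun I J h => ?_) fun I J h => ?_
    · exact Ideal.span_mono (Set.image_mono h)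
    · ext a
      rw [← key, h, key]
  rw [isNoetherianRing_iff, isNoetherian_iff']
  exact hf.wellFoundedGT

/-- Reduction of the even part modulo a prime ideal, as a homomorphism on the whole superring. -/
def evenQuotientMk {R : Superring.{u}} (p : Ideal R.evenSubring) [hp : p.IsPrime] :
    R →+* R.evenSubring ⧸ p where
  toFun x := Ideal.Quotient.mk p ⟨evenPart R.grading x, evenPart_mem _ _⟩
  map_one' := by
    rw [← map_one (Ideal.Quotient.mk p)]
    exact congrArg _ (Subtype.ext (evenPart_of_even _ SetLike.GradedOne.one_mem))
  map_zero' := by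
    rw [← map_zero (Ideal.Quotient.mk p)]
    exact congrArg _ (Subtype.ext (map_zero _))
  map_add' x y := by
    rw [← map_add]
    exact congrArg _ (Subtype.ext (map_add _ _ _))
  map_mul' x y := by
    rw [← map_mul, Ideal.Quotient.eq]
    -- The defect of multiplicativity is the product of the two odd parts, whose square is zero.
    refine hp.mem_of_pow_mem 2 ?_
    convert p.zero_mem
    refine Subtype.ext ?_
    simpa [pow_two, evenPart_mul x y] using
      odd_mul_odd_sq (sub_evenPart_mem R.grading x) (sub_evenPart_mem R.grading y)

lemma mem_ker_evenQuotientMk {R : Superring.{u}} (p : Ideal R.evenSubring) [hp : p.IsPrime]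
    (a : R.evenSubring) : (a : R) ∈ RingHom.ker (evenQuotientMk p) ↔ a ∈ p := by
  rw [RingHom.mem_ker]
  change Ideal.Quotient.mk p _ = 0 ↔ _
  rw [Ideal.Quotient.eq_zero_iff_mem]
  exact iff_of_eq (congrArg (· ∈ p) (Subtype.ext (evenPart_of_even _ a.2)))

lemma isPrimeIdeal_ker_evenQuotientMk {R : Superring.{u}} (p : Ideal R.evenSubring)
    [hp : p.IsPrime] : R.IsPrimeIdeal (RingHom.ker (evenQuotientMk p)) := by
  have inj := RingHom.kerLift_injective (evenQuotientMk p)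
  exact ⟨inferInstance, inj.isDomain _, fun x y => inj (by rw [map_mul, map_mul, mul_comm])⟩

lemma IsPrimeIdeal.comap_isPrime {R : Superring.{u}} {p : Ideal R} (hp : R.IsPrimeIdeal p) :
    (p.comap R.evenSubring.subtype).IsPrime := by
  obtain ⟨_, hd, _⟩ := hp
  refine ⟨fun h => ?_, fun {x y} h => ?_⟩
  · rw [Ideal.eq_top_iff_one, Ideal.mem_comap, map_one] at h
    exact one_ne_zero (α := R ⧸ p) (Ideal.Quotient.eq_zero_iff_mem.mpr h)
  · rw [Ideal.mem_comap, map_mul, ← Ideal.Quotient.eq_zero_iff_mem, map_mul, mul_eq_zero] at h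
    exact h.imp (fun h => Ideal.mem_comap.mpr (Ideal.Quotient.eq_zero_iff_mem.mp h))
      fun h => Ideal.mem_comap.mpr (Ideal.Quotient.eq_zero_iff_mem.mp h)

end Superring

/-! ### Localization at a prime in terms of one even generator -/

namespace Supermodule

open OreLocalization

variable {R : Superring.{u}}

lemma exists_eq_oreDiv (M : Supermodule R) {p : Ideal R} {hp : R.IsPrimeIdeal p}
    (x : M.LocalizationAt p hp) : ∃ m s, x = m /ₒ s :=
  OreLocalization.ind (fun m s => ⟨m, s, rfl⟩) x

/-- Denominators are central, so the Ore relation reduces to the criterion familiar from commutative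
localization. -/
lemma oreDiv_eq_oreDiv_iff (M : Supermodule R) {p : Ideal R} {hp : R.IsPrimeIdeal p} (m n : M)
    (s t : R.primeCompl p hp) :
    (m /ₒ s : M.LocalizationAt p hp) = n /ₒ t ↔
      ∃ u : R.primeCompl p hp, (u : R) • (t : R) • m = (u : R) • (s : R) • n := by
  rw [oreDiv_eq_iff]
  constructor
  · rintro ⟨u, v, h, h'⟩
    refine ⟨u, ?_⟩
    rw [smul_smul, h', mul_smul, smul_smul v, ← R.even_comm s.2.1, mul_smul, ← h,
      Submonoid.smul_def, smul_smul, smul_smul, R.even_comm u.2.1]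
  · rintro ⟨u, h⟩
    refine ⟨u * s, u * t, ?_, ?_⟩
    · rw [Submonoid.smul_def, Submonoid.coe_mul, mul_smul, mul_smul, h]
    · rw [Submonoid.coe_mul, mul_assoc, mul_assoc, R.even_comm s.2.1]

lemma oreDiv_eq_zero_iff (M : Supermodule R) {p : Ideal R} {hp : R.IsPrimeIdeal p} (m : M)
    (s : R.primeCompl p hp) :
    (m /ₒ s : M.LocalizationAt p hp) = 0 ↔ ∃ t : R.primeCompl p hp, (t : R) • m = 0 := by
  rw [OreLocalization.zero_def, oreDiv_eq_oreDiv_iff]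
  simp

lemma oreDiv_smul_oreDiv_eq (M : Supermodule R) {p : Ideal R} {hp : R.IsPrimeIdeal p} (r : R)
    (m : M) (s t : R.primeCompl p hp) :
    (r /ₒ t : OreLocalization (R.primeCompl p hp) R) • (m /ₒ s : M.LocalizationAt p hp) =
      (r • m) /ₒ (s * t) :=
  oreDiv_smul_char _ _ _ _ _ _ (R.even_comm s.2.1 r)

/-- The unit of R_p is even, so its odd component vanishes. The argument clears denominators and
compares parities in R, so no direct sum decomposition of R_p is needed. -/
lemma oreDiv_eq_zero_of_add_eq_one {p : Ideal R} {hp : R.IsPrimeIdeal p} {a b : R}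
    (ha : a ∈ R.grading 0) (hb : b ∈ R.grading 1) (s t : R.primeCompl p hp)
    (h : (a /ₒ s + b /ₒ t : OreLocalization (R.primeCompl p hp) R) = 1) :
    (b /ₒ t : OreLocalization (R.primeCompl p hp) R) = 0 := by
  have hab : (a /ₒ s + b /ₒ t : OreLocalization (R.primeCompl p hp) R) =
      ((t : R) * a + (s : R) * b) /ₒ (t * s) := by
    rw [← add_oreDiv, OreLocalization.expand' a s t, OreLocalization.expand' b t s]
    congr 2
    exact Subtype.ext (R.even_comm s.2.1 _)
  rw [hab, OreLocalization.one_def] at h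
  obtain ⟨u, hu⟩ := ((unit R).oreDiv_eq_oreDiv_iff _ _ _ _).mp h
  refine ((unit R).oreDiv_eq_zero_iff b t).mpr ⟨u * s, ?_⟩
  have he : ∀ {x y : R}, x ∈ R.grading 0 → y ∈ R.grading 0 → x * y ∈ R.grading 0 :=
    fun hx hy => R.evenSubring.mul_mem hx hy
  have ho : ∀ {x y : R}, x ∈ R.grading 0 → y ∈ R.grading 1 → x * y ∈ R.grading 1 :=
    fun hx hy => by simpa using SetLike.GradedMul.mul_mem hx hy
  have h1 : (u : R) * (s * b) = u * (t * s) - u * (t * a) := by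
    rw [eq_sub_iff_add_eq, ← mul_add, add_comm]
    simpa using hu
  -- The element usb is odd as written, and even by `h1`, hence zero.
  have h2 := evenPart_of_odd R.grading (ho u.2.1 (ho s.2.1 hb))
  rw [h1, evenPart_of_even R.grading (sub_mem (he u.2.1 (he t.2.1 s.2.1))
    (he u.2.1 (he t.2.1 ha))), ← h1] at h2
  rwa [smul_eq_mul, Submonoid.coe_mul, mul_assoc]

/-- The generator is the even part of the numerator of a preimage of 1: the odd part contributes an
odd fraction, which must vanish because 1 is even. -/
lemma exists_local_generator (M : Supermodule R) {p : Ideal R} {hp : R.IsPrimeIdeal p}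
    (f : M.LocalizationAt p hp
      ≃ₗ[OreLocalization (R.primeCompl p hp) R] (unit R).LocalizationAt p hp)
    (hf : ∀ (i : ZMod 2), ∀ x ∈ M.localizationGrading p hp i,
      f x ∈ (unit R).localizationGrading p hp i) :
    ∃ m : M.evenSubmodule, (∀ x : M, ∃ t ∈ R.primeCompl p hp, ∃ r : R, t • x = r • (m : M)) ∧
      ∀ r : R, r • (m : M) = 0 → ∃ t ∈ R.primeCompl p hp, t • r = 0 := by
  obtain ⟨m, s, hms⟩ : ∃ m s, f (m /ₒ s) = 1 := by
    obtain ⟨x, hx⟩ := f.surjective 1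
    obtain ⟨m, s, rfl⟩ := M.exists_eq_oreDiv x
    exact ⟨m, s, hx⟩
  set m₀ := evenPart M.grading m
  have hm₀ := evenPart_mem M.grading m
  have hm₁ := sub_evenPart_mem M.grading m
  obtain ⟨a, ha, u, hau⟩ := hf 0 (m₀ /ₒ s) ⟨m₀, hm₀, s, rfl⟩
  obtain ⟨b, hb, v, hbv⟩ := hf 1 ((m - m₀) /ₒ s) ⟨m - m₀, hm₁, s, rfl⟩
  have hsum : (m /ₒ s : M.LocalizationAt p hp) = m₀ /ₒ s + (m - m₀) /ₒ s := by
    rw [add_oreDiv, add_sub_cancel]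
  have hm : f (m₀ /ₒ s) = 1 := by
    rw [hsum, map_add] at hms
    have h := hms
    rw [hau, hbv] at h
    rw [hbv, oreDiv_eq_zero_of_add_eq_one ha hb u v h, add_zero] at hms
    exact hms
  refine ⟨⟨m₀, hm₀⟩, fun x => ?_, fun r hr => ?_⟩
  · obtain ⟨r, t, hrt⟩ := (unit R).exists_eq_oreDiv (f (x /ₒ 1))
    have h : f (x /ₒ 1) = f ((r /ₒ t : OreLocalization (R.primeCompl p hp) R) • (m₀ /ₒ s)) := by
      rw [hrt, map_smul, hm]
      exact (mul_one _).symm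
    obtain ⟨w, hw⟩ := (M.oreDiv_eq_oreDiv_iff _ _ _ _).mp
      ((f.injective h).trans (M.oreDiv_smul_oreDiv_eq r m₀ s t))
    refine ⟨w * (s * t), (w * (s * t)).2, w * r, ?_⟩
    simpa [mul_smul] using hw
  · have h : f ((r /ₒ 1 : OreLocalization (R.primeCompl p hp) R) • (m₀ /ₒ s)) = 0 := by
      rw [M.oreDiv_smul_oreDiv_eq, hr, zero_oreDiv, map_zero]
    rw [map_smul, hm] at h
    obtain ⟨t, ht⟩ := ((unit R).oreDiv_eq_zero_iff r 1).mp ((mul_one _).symm.trans h)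
    exact ⟨t, t.2, ht⟩

/-- The isomorphism is inverse to r/s ↦ rm/s; the two conditions on m give surjectivity and
injectivity after clearing denominators. -/
lemma exists_localization_equiv (M : Supermodule R) {p : Ideal R} {hp : R.IsPrimeIdeal p}
    (m : M.evenSubmodule)
    (hm : ∀ x : M, ∃ t ∈ R.primeCompl p hp, ∃ r : R, t • x = r • (m : M))
    (hm' : ∀ r : R, r • (m : M) = 0 → ∃ t ∈ R.primeCompl p hp, t • r = 0) :
    ∃ f : M.LocalizationAt p hp
        ≃ₗ[OreLocalization (R.primeCompl p hp) R] (unit R).LocalizationAt p hp,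
      ∀ (i : ZMod 2), ∀ x ∈ M.localizationGrading p hp i,
        f x ∈ (unit R).localizationGrading p hp i := by
  let g : OreLocalization (R.primeCompl p hp) R →ₗ[OreLocalization (R.primeCompl p hp) R]
      M.LocalizationAt p hp := LinearMap.toSpanSingleton _ _ ((m : M) /ₒ 1)
  have hg : ∀ r s, g (r /ₒ s) = (r • (m : M)) /ₒ s := by
    intro r s
    rw [LinearMap.toSpanSingleton_apply, oreDiv_smul_oreDiv_eq, one_mul]
  have hdiv : ∀ (x : M) (s t : R.primeCompl p hp) (r : R), (t : R) • x = r • (m : M) →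
      g (r /ₒ (t * s)) = x /ₒ s := by
    intro x s t r h
    rw [hg, ← h, OreLocalization.expand' x s t, Submonoid.smul_def]
  have inj : Function.Injective g := by
    rw [injective_iff_map_eq_zero]
    intro y hy
    induction y with
    | c r s =>
      rw [hg] at hy
      obtain ⟨t, ht⟩ := (M.oreDiv_eq_zero_iff _ _).mp hy
      rw [smul_smul] at ht
      obtain ⟨u, hu, hur⟩ := hm' _ ht
      refine ((unit R).oreDiv_eq_zero_iff r s).mpr ⟨⟨u, hu⟩ * t, ?_⟩
      rw [Submonoid.coe_mul, mul_smul]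
      exact hur
  have surj : Function.Surjective g := by
    intro y
    obtain ⟨x, s, rfl⟩ := M.exists_eq_oreDiv y
    obtain ⟨t, ht, r, h⟩ := hm x
    exact ⟨_, hdiv x s ⟨t, ht⟩ r h⟩
  let e := LinearEquiv.ofBijective g ⟨inj, surj⟩
  refine ⟨e.symm, ?_⟩
  rintro i _ ⟨x, hx, s, rfl⟩
  obtain ⟨t, ht, r, h⟩ := hm x
  -- As m is even, comparing components of degree i in tx = rm allows r to be replaced by its
  -- component of degree i.
  obtain ⟨r', hr', h'⟩ : ∃ r' ∈ R.grading i, t • x = r' • (m : M) := by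
    have htx := M.smul_mem_grading ht.1 hx
    rw [zero_add] at htx
    rcases parity_cases i with rfl | rfl
    · refine ⟨evenPart R.grading r, evenPart_mem _ _, ?_⟩
      rw [← M.evenPart_smul_of_even r m.2, ← h, evenPart_of_even _ htx]
    · refine ⟨r - evenPart R.grading r, sub_evenPart_mem _ _, ?_⟩
      rw [sub_smul, ← M.evenPart_smul_of_even r m.2, ← h, evenPart_of_odd _ htx, sub_zero]
  refine ⟨r', hr', ⟨t, ht⟩ * s, ?_⟩
  rw [LinearEquiv.symm_apply_eq]
  exact (hdiv x s ⟨t, ht⟩ r' h').symm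

/-- Local freeness of rank `1|0` in terms of the spectrum of the even part. -/
lemma hasLocalGenerators_iff (M : Supermodule R) : M.HasLocalGenerators ↔
    ∀ (p : Ideal R) (hp : R.IsPrimeIdeal p),
      ∃ f : M.LocalizationAt p hp
          ≃ₗ[OreLocalization (R.primeCompl p hp) R] (unit R).LocalizationAt p hp,
        ∀ (i : ZMod 2), ∀ x ∈ M.localizationGrading p hp i,
          f x ∈ (unit R).localizationGrading p hp i := by
  constructor
  · intro h p hp
    obtain ⟨m, h1, h2⟩ := h _ hp.comap_isPrime
    refine M.exists_localization_equiv m (fun x => ?_) fun r hr => ?_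
    · obtain ⟨t, ht, r, htr⟩ := h1 x
      exact ⟨t, ⟨t.2, ht⟩, r, htr⟩
    · obtain ⟨t, ht, htr⟩ := h2 r hr
      exact ⟨t, ⟨t.2, ht⟩, htr⟩
  · intro h p hp
    -- This prime of R contracts to p, so the two sets of denominators agree.
    obtain ⟨f, hf⟩ := h _ (Superring.isPrimeIdeal_ker_evenQuotientMk p)
    obtain ⟨m, h1, h2⟩ := M.exists_local_generator f hf
    refine ⟨m, fun x => ?_, fun r hr => ?_⟩
    · obtain ⟨t, ht, r, htr⟩ := h1 x
      exact ⟨⟨t, ht.1⟩, fun h => ht.2 ((Superring.mem_ker_evenQuotientMk p ⟨t, ht.1⟩).mpr h),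
        r, htr⟩
    · obtain ⟨t, ht, htr⟩ := h2 r hr
      exact ⟨⟨t, ht.1⟩, fun h => ht.2 ((Superring.mem_ker_evenQuotientMk p ⟨t, ht.1⟩).mpr h), htr⟩

end Supermodule

/-! ### Invertible modules over a commutative ring, prime by prime -/

section LocalTriviality

variable {A : Type*} [CommRing A] {L : Type*} [AddCommGroup L] [Module A L]

/-- An element annihilated locally at each prime is zero. -/
lemma eq_zero_of_local (x : L)
    (h : ∀ p : Ideal A, p.IsPrime → ∃ t : A, t ∉ p ∧ t • x = 0) : x = 0 := by
  by_contra hx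
  -- The annihilator of a nonzero x is proper, so a maximal ideal contains it, which contradicts the
  -- hypothesis there.
  have hne : Ideal.torsionOf A L x ≠ ⊤ := fun h => hx ((Ideal.torsionOf_eq_top_iff A x).mp h)
  obtain ⟨p, hp, hle⟩ := Ideal.exists_le_maximal _ hne
  obtain ⟨t, ht, htx⟩ := h p hp.isPrime
  exact ht (hle ((Ideal.mem_torsionOf_iff x t).mpr htx))

/-- Membership in a submodule is local. -/
lemma mem_of_local (N : Submodule A L) (x : L)
    (h : ∀ p : Ideal A, p.IsPrime → ∃ t : A, t ∉ p ∧ t • x ∈ N) : x ∈ N := by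
  rw [← Submodule.Quotient.mk_eq_zero]
  refine eq_zero_of_local (A := A) _ fun p hp => ?_
  obtain ⟨t, ht, htx⟩ := h p hp
  exact ⟨t, ht, by rwa [← Submodule.Quotient.mk_smul, Submodule.Quotient.mk_eq_zero]⟩

/-- Common denominators in a finite module. -/
lemma exists_common_denominator [Module.Finite A L] {p : Ideal A} (hp : p.IsPrime)
    (N : Submodule A L) (h : ∀ x : L, ∃ t : A, t ∉ p ∧ t • x ∈ N) :
    ∃ t : A, t ∉ p ∧ ∀ x : L, t • x ∈ N := by
  obtain ⟨s, hs⟩ := Module.Finite.fg_top (R := A) (M := L)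
  choose t ht htx using h
  refine ⟨∏ x ∈ s, t x, fun hmem => ?_, fun x => ?_⟩
  · obtain ⟨x, -, hx⟩ := hp.prod_mem_iff.mp hmem
    exact ht x hx
  · have hx : x ∈ Submodule.span A (s : Set L) := hs ▸ Submodule.mem_top
    induction hx using Submodule.span_induction with
    | zero => simp
    | add x y _ _ hx hy => rw [smul_add]; exact add_mem hx hy
    | smul a x _ hx => rw [smul_comm]; exact N.smul_mem a hx
    | mem x hx =>
      classical
      rw [← Finset.prod_erase_mul s t hx, mul_smul]
      exact N.smul_mem _ (htx x)

/-- Over a Noetherian ring, a finite module that is locally free on one generator is invertible. -/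
lemma Module.Invertible.of_local [IsNoetherianRing A] [Module.Finite A L]
    (h : ∀ p : Ideal A, p.IsPrime → ∃ m : L, (∀ x : L, ∃ t : A, t ∉ p ∧ ∃ a : A, t • x = a • m) ∧
      ∀ a : A, a • m = 0 → ∃ t : A, t ∉ p ∧ t • a = 0) :
    Module.Invertible A L := by
  have h' : ∀ p : Ideal A, p.IsPrime → ∃ (m : L) (t u : A), t ∉ p ∧ u ∉ p ∧
      (∀ x : L, ∃ a : A, t • x = a • m) ∧ ∀ a : A, a • m = 0 → u * a = 0 := by
    intro p hp
    obtain ⟨m, h1, h2⟩ := h p hp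
    obtain ⟨t, ht, htx⟩ := exists_common_denominator hp (Submodule.span A {m}) fun x => by
      obtain ⟨t, ht, a, hta⟩ := h1 x
      exact ⟨t, ht, Submodule.mem_span_singleton.mpr ⟨a, hta.symm⟩⟩
    -- The annihilator of m is finitely generated because A is Noetherian, so a single u kills it.
    obtain ⟨u, hu, hua⟩ := exists_common_denominator (L := Ideal.torsionOf A L m) hp ⊥ fun x => by
      obtain ⟨t, ht, hta⟩ := h2 x ((Ideal.mem_torsionOf_iff m _).mp x.2)
      exact ⟨t, ht, Subtype.ext hta⟩
    refine ⟨m, t, u, ht, hu, fun x => ?_, fun a ha => ?_⟩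
    · obtain ⟨a, ha⟩ := Submodule.mem_span_singleton.mp (htx x)
      exact ⟨a, ha.symm⟩
    · exact congrArg Subtype.val (hua ⟨a, (Ideal.mem_torsionOf_iff m _).mpr ha⟩)
  refine ⟨(injective_iff_map_eq_zero _).mpr fun z hz => ?_, LinearMap.range_eq_top.mp ?_⟩
  · refine eq_zero_of_local (A := A) z fun p hp => ?_
    obtain ⟨m, t, u, ht, hu, htx, hum⟩ := h' p hp
    -- With the uniform denominator t, every second factor becomes a multiple of m, so tz is a pure
    -- tensor.
    have hz' : ∃ g : Module.Dual A L, t • z = g ⊗ₜ[A] m := by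
      clear hz
      induction z using TensorProduct.induction_on with
      | zero => exact ⟨0, by simp⟩
      | add x y hx hy =>
        obtain ⟨g, hg⟩ := hx
        obtain ⟨g', hg'⟩ := hy
        exact ⟨g + g', by rw [smul_add, hg, hg', TensorProduct.add_tmul]⟩
      | tmul g x =>
        obtain ⟨a, ha⟩ := htx x
        exact ⟨a • g, by rw [← TensorProduct.tmul_smul, ha, TensorProduct.smul_tmul]⟩
    obtain ⟨g, hg⟩ := hz'
    have hgm : g m = 0 := by
      rw [← contractLeft_apply (R := A) g m, ← hg, map_smul, hz, smul_zero]
    -- Each tx is a multiple of m, and g vanishes on m.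
    have htg : t • g = 0 := by
      ext x
      obtain ⟨a, ha⟩ := htx x
      rw [LinearMap.smul_apply, ← map_smul, ha, map_smul, hgm, smul_zero, LinearMap.zero_apply]
    exact ⟨t * t, hp.mul_notMem ht ht, by
      rw [mul_smul, hg, TensorProduct.smul_tmul', htg, TensorProduct.zero_tmul]⟩
  · rw [eq_top_iff]
    refine fun x _ => mem_of_local _ x fun p hp => ?_
    obtain ⟨m, t, u, ht, hu, htx, hum⟩ := h' p hp
    choose c hc using htx
    have huc : ∀ a b : A, a • m = b • m → u * a = u * b := fun a b hab => by
      rw [← sub_eq_zero, ← mul_sub]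
      exact hum _ (by rw [sub_smul, hab, sub_self])
    -- The coefficient c(x) in tx = c(x)m is determined only modulo the annihilator of m;
    -- multiplying by u makes it well defined and linear. Since f(m) = ut, evaluation reaches an
    -- element outside p.
    let f : Module.Dual A L :=
      { toFun := fun x => u * c x
        map_add' := fun x y => by
          rw [← mul_add]
          exact huc _ _ (by rw [← hc, smul_add, add_smul, hc, hc])
        map_smul' := fun a x => by
          rw [RingHom.id_apply, smul_eq_mul, mul_left_comm]
          exact huc _ _ (by rw [← hc, mul_smul, ← hc, smul_comm]) }
    refine ⟨u * t, hp.mul_notMem hu ht, x • f ⊗ₜ[A] m, ?_⟩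
    rw [map_smul, contractLeft_apply, smul_eq_mul, smul_eq_mul, mul_comm]
    exact congrArg (· * x) (huc _ _ (hc m).symm)

/-- Invertible modules are locally free on one generator. -/
lemma Module.Invertible.exists_local_generator [Module.Invertible A L] {p : Ideal A}
    (hp : p.IsPrime) : ∃ (f : Module.Dual A L) (m : L) (c : A), f m ∉ p ∧ c ∉ p ∧
      ∀ x, c • x = f x • m := by
  -- Otherwise the image of the contraction would lie in p, although it contains 1.
  obtain ⟨f, m, hfm⟩ : ∃ (f : Module.Dual A L) (m : L), f m ∉ p := by
    by_contra! hmem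
    refine hp.ne_top ((Ideal.eq_top_iff_one p).mpr ?_)
    obtain ⟨z, hz⟩ := (Module.Invertible.bijective (R := A) (M := L)).2 1
    rw [← hz]
    clear hz
    induction z using TensorProduct.induction_on with
    | zero => simp
    | add x y hx hy => rw [map_add]; exact add_mem hx hy
    | tmul f m => exact hmem f m
  -- Endomorphisms of an invertible module are scalars; evaluating f at cm = f(m)m gives c·f(m) =
  -- f(m)², so c ∉ p.
  obtain ⟨c, hc⟩ := (Module.Invertible.toModuleEnd_bijective A L).2 (f.smulRight m)
  have hc' : ∀ x, c • x = f x • m := fun x => LinearMap.congr_fun hc x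
  refine ⟨f, m, c, hfm, fun h => hp.mul_notMem hfm hfm ?_, hc'⟩
  rw [← smul_eq_mul, ← map_smul, ← hc' m, map_smul]
  exact p.mul_mem_right _ h

end LocalTriviality

/-! ### Invertible supermodules are induced from the even part -/

namespace Supermodule

variable {R : Superring.{u}} (M : Supermodule R)

/-- Both halves are local on Spec R₀. Near p every tensor becomes r ⊗ m, with image rm, and the
local generator m controls both its annihilator and the range. -/
lemma HasLocalGenerators.evenMul_bijective {M : Supermodule R} (h : M.HasLocalGenerators) :
    Function.Bijective M.evenMul := by
  constructor
  · refine (injective_iff_map_eq_zero _).mpr fun z hz => ?_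
    refine eq_zero_of_local (A := R.evenSubring) z fun p hp => ?_
    obtain ⟨m, h1, h2⟩ := h p hp
    have h1' : ∀ x : M.evenSubmodule, ∃ t : R.evenSubring, t ∉ p ∧ ∃ a : R.evenSubring,
        t • x = a • m := by
      intro x
      obtain ⟨t, ht, r, hr⟩ := h1 x
      -- For x even, taking even parts in tx = rm replaces r by its even part.
      refine ⟨t, ht, ⟨evenPart R.grading r, evenPart_mem _ _⟩, Subtype.ext ?_⟩
      refine Eq.trans ?_ (M.evenPart_smul_of_even r m.2)
      rw [← hr]
      exact (evenPart_of_even _ (t • x).2).symm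
    have hz' : ∃ t : R.evenSubring, t ∉ p ∧ ∃ r : R, t • z = r ⊗ₜ[R.evenSubring] m := by
      clear hz
      induction z using TensorProduct.induction_on with
      | zero => exact ⟨1, hp.one_notMem, 0, by simp⟩
      | add x y hx hy =>
        obtain ⟨t, ht, r, hr⟩ := hx
        obtain ⟨t', ht', r', hr'⟩ := hy
        refine ⟨t * t', hp.mul_notMem ht ht', t' • r + t • r', ?_⟩
        rw [smul_add, mul_comm t, mul_smul, hr, mul_comm, mul_smul, hr', TensorProduct.add_tmul,
          TensorProduct.smul_tmul', TensorProduct.smul_tmul']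
      | tmul r x =>
        obtain ⟨t, ht, a, ha⟩ := h1' x
        exact ⟨t, ht, a • r, by rw [← TensorProduct.tmul_smul, ha, TensorProduct.smul_tmul]⟩
    obtain ⟨t, ht, r, hr⟩ := hz'
    have hrm : r • (m : M) = 0 := by
      rw [← evenMul_tmul, ← hr, LinearMap.map_smul_of_tower, hz, smul_zero]
    obtain ⟨u, hu, hur⟩ := h2 r hrm
    exact ⟨u * t, hp.mul_notMem hu ht, by
      rw [mul_smul, hr, TensorProduct.smul_tmul', hur, TensorProduct.zero_tmul]⟩
  · intro x
    refine mem_of_local (LinearMap.range (M.evenMul.restrictScalars R.evenSubring)) x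
      fun p hp => ?_
    obtain ⟨m, h1, -⟩ := h p hp
    obtain ⟨t, ht, r, hr⟩ := h1 x
    exact ⟨t, ht, r ⊗ₜ m, hr.symm⟩

/-- If `M` is a finite module generated by its even part then its even part is finite. -/
lemma finite_evenSubmodule (hfin : Module.Finite R M) (hsurj : Function.Surjective M.evenMul) :
    Module.Finite R.evenSubring M.evenSubmodule := by
  have hspan : Submodule.span R (M.evenSubmodule : Set M) = ⊤ := by
    rw [eq_top_iff]
    intro x _
    obtain ⟨z, rfl⟩ := hsurj x
    induction z using TensorProduct.induction_on with
    | zero => simp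
    | add x y hx hy => rw [map_add]; exact add_mem (hx trivial) (hy trivial)
    | tmul r m => exact Submodule.smul_mem _ _ (Submodule.subset_span m.2)
  obtain ⟨s, hs, hs'⟩ := Submodule.fg_span_iff_fg_span_finset_subset _ |>.mp
    (hspan.symm ▸ hfin.fg_top : (Submodule.span R (M.evenSubmodule : Set M)).FG)
  rw [hspan] at hs'
  classical
  rw [Module.finite_def, Submodule.fg_def]
  refine ⟨M.evenProj '' s, s.finite_toSet.image _, ?_⟩
  rw [eq_top_iff]
  rintro x -
  -- The generators in s are even, so the even part of a combination of them has as coefficients the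
  -- even parts of the original ones.
  have aux : ∀ y ∈ Submodule.span R (s : Set M), ∀ r : R,
      M.evenProj (r • y) ∈ Submodule.span R.evenSubring (M.evenProj '' s) := by
    intro y hy
    induction hy using Submodule.span_induction with
    | zero => simp
    | add x y _ _ hx hy => intro r; rw [smul_add, map_add]; exact add_mem (hx r) (hy r)
    | smul a x _ hx => intro r; rw [smul_smul]; exact hx _
    | mem y hy =>
      intro r
      have h : M.evenProj (r • y) = (⟨evenPart R.grading r, evenPart_mem _ _⟩ : R.evenSubring) •
          M.evenProj y := by
        refine Subtype.ext ((M.evenPart_smul_of_even r (hs hy)).trans ?_)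
        exact congrArg (evenPart R.grading r • ·) (evenPart_of_even _ (hs hy)).symm
      rw [h]
      exact Submodule.smul_mem _ _ (Submodule.subset_span ⟨y, hy, rfl⟩)
  have := aux x (hs' ▸ Submodule.mem_top) 1
  rwa [one_smul, evenProj_apply] at this

/-- A local generator of M₀ also generates M locally, since M is R ⊗ M₀. Its annihilator in R dies
locally on applying id ⊗ f, where f is a functional with f(m) ∉ p. -/
lemma IsInducedInvertible.hasLocalGenerators {M : Supermodule R} (h : M.IsInducedInvertible) :
    M.HasLocalGenerators := by
  intro p hp
  have := h.invertible
  obtain ⟨f, m, c, hfm, hc, hcx⟩ :=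
    Module.Invertible.exists_local_generator (L := M.evenSubmodule) hp
  refine ⟨m, fun x => ?_, fun r hr => ?_⟩
  · obtain ⟨z, rfl⟩ := h.bijective.2 x
    refine ⟨c, hc, ?_⟩
    induction z using TensorProduct.induction_on with
    | zero => exact ⟨0, by simp⟩
    | add x y hx hy =>
      obtain ⟨r, hr⟩ := hx
      obtain ⟨r', hr'⟩ := hy
      exact ⟨r + r', by rw [map_add, smul_add, hr, hr', add_smul]⟩
    | tmul r x =>
      refine ⟨f x • r, ?_⟩
      rw [← LinearMap.map_smul_of_tower, ← TensorProduct.tmul_smul, hcx,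
        ← TensorProduct.smul_tmul, evenMul_tmul]
  · have hz : r ⊗ₜ[R.evenSubring] m = 0 := h.bijective.1 (by rw [map_zero]; exact hr)
    have hf := congrArg (TensorProduct.rid R.evenSubring R ∘ f.lTensor R) hz
    simp only [Function.comp_apply, LinearMap.lTensor_tmul, TensorProduct.rid_tmul, map_zero] at hf
    exact ⟨f m, hfm, hf⟩

/-- Over a Noetherian superring the invertible supermodules are the supermodules induced from
invertible modules over the even part. -/
theorem isInvertible_iff (hR : R.IsNoetherian) (M : Supermodule R) :
    M.IsInvertible ↔ M.IsInducedInvertible := by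
  have := Superring.evenSubring_isNoetherianRing hR
  constructor
  · rintro ⟨⟨s, -, hs⟩, hloc⟩
    have hgen := M.hasLocalGenerators_iff.mpr hloc
    have hbij := hgen.evenMul_bijective
    have := M.finite_evenSubmodule ⟨s, hs⟩ hbij.2
    refine ⟨Module.Invertible.of_local fun p hp => ?_, hbij⟩
    obtain ⟨m, h1, h2⟩ := hgen p hp
    refine ⟨m, fun x => ?_, fun a ha => ?_⟩
    · obtain ⟨t, ht, r, hr⟩ := h1 x
      refine ⟨t, ht, ⟨evenPart R.grading r, evenPart_mem _ _⟩, Subtype.ext ?_⟩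
      refine Eq.trans ?_ (M.evenPart_smul_of_even r m.2)
      rw [← hr]
      exact (evenPart_of_even _ (t • x).2).symm
    · obtain ⟨t, ht, h⟩ := h2 a (congrArg Subtype.val ha)
      exact ⟨t, ht, Subtype.ext h⟩
  · intro h
    refine ⟨?_, M.hasLocalGenerators_iff.mp h.hasLocalGenerators⟩
    have := h.invertible
    obtain ⟨s, hs⟩ := Module.Finite.fg_top (R := R.evenSubring) (M := M.evenSubmodule)
    classical
    refine ⟨s.image Subtype.val, fun m hm => ?_, ?_⟩
    · obtain ⟨m, -, rfl⟩ := Finset.mem_image.mp hm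
      exact ⟨0, m.2⟩
    · rw [eq_top_iff]
      rintro x -
      obtain ⟨z, rfl⟩ := h.bijective.2 x
      induction z using TensorProduct.induction_on with
      | zero => simp
      | add x y hx hy => rw [map_add]; exact add_mem hx hy
      | tmul r m =>
        refine Submodule.smul_mem _ _ ?_
        have hm : m ∈ Submodule.span R.evenSubring (s : Set M.evenSubmodule) :=
          hs ▸ Submodule.mem_top
        induction hm using Submodule.span_induction with
        | zero => simp
        | add x y _ _ hx hy => exact add_mem hx hy
        | smul a x _ hx => exact Submodule.smul_mem _ (a : R) hx
        | mem x hx => exact Submodule.subset_span (Finset.mem_coe.mpr (Finset.mem_image_of_mem _ hx))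

end Supermodule

/-! ### Induced supermodules and their even parts -/

namespace Supermodule

variable {R : Superring.{u}}

/-- This reduces parity checks on induced modules to products of a homogeneous scalar and an even
element. -/
lemma mem_closure_smul_even {M : Supermodule R} (hM : Function.Surjective M.evenMul) {i : ZMod 2}
    {x : M} (hx : x ∈ M.grading i) :
    x ∈ AddSubgroup.closure {y : M | ∃ r ∈ R.grading i, ∃ m : M.evenSubmodule, y = r • (m : M)} := by
  obtain ⟨z, rfl⟩ := hM x
  have key : evenPart M.grading (M.evenMul z) ∈ AddSubgroup.closure
        {y : M | ∃ r ∈ R.grading 0, ∃ m : M.evenSubmodule, y = r • (m : M)} ∧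
      M.evenMul z - evenPart M.grading (M.evenMul z) ∈ AddSubgroup.closure
        {y : M | ∃ r ∈ R.grading 1, ∃ m : M.evenSubmodule, y = r • (m : M)} := by
    clear hx
    induction z using TensorProduct.induction_on with
    | zero => simp
    | add x y hx hy =>
      simp only [map_add, add_sub_add_comm]
      exact ⟨add_mem hx.1 hy.1, add_mem hx.2 hy.2⟩
    | tmul r m =>
      rw [evenMul_tmul, M.evenPart_smul_of_even r m.2, ← sub_smul]
      exact ⟨AddSubgroup.subset_closure ⟨_, evenPart_mem _ _, m, rfl⟩,
        AddSubgroup.subset_closure ⟨_, sub_evenPart_mem _ _, m, rfl⟩⟩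
  rcases parity_cases i with rfl | rfl
  · rw [evenPart_of_even _ hx] at key
    exact key.1
  · rw [evenPart_of_odd _ hx, sub_zero] at key
    exact key.2

/-- A map of even parts determines a map of induced supermodules. -/
lemma isomorphic_of_evenSubmodule {M N : Supermodule R} (hM : M.IsInducedInvertible)
    (hN : N.IsInducedInvertible) (e : M.evenSubmodule ≃ₗ[R.evenSubring] N.evenSubmodule) :
    Isomorphic M N := by
  let f : M ≃ₗ[R] N := (LinearEquiv.ofBijective _ hM.bijective).symm ≪≫ₗ
    TensorProduct.AlgebraTensorModule.congr (LinearEquiv.refl R R) e ≪≫ₗ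
    LinearEquiv.ofBijective _ hN.bijective
  have hf : ∀ (r : R) (m : M.evenSubmodule), f (r • (m : M)) = r • (e m : N) := by
    intro r m
    have h : (LinearEquiv.ofBijective _ hM.bijective).symm (r • (m : M)) = r ⊗ₜ m := by
      rw [LinearEquiv.symm_apply_eq]; rfl
    simp only [f, LinearEquiv.trans_apply, h]
    rfl
  refine ⟨f, fun i x hx => ?_⟩
  replace hx := mem_closure_smul_even hM.bijective.2 hx
  induction hx using AddSubgroup.closure_induction with
  | zero => simp
  | add x y _ _ hx hy => rw [map_add]; exact add_mem hx hy
  | neg x _ hx => rw [map_neg]; exact neg_mem hx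
  | mem x hx =>
    obtain ⟨r, hr, m, rfl⟩ := hx
    rw [hf, ← add_zero i]
    exact N.smul_mem_grading hr (e m).2

/-- Isomorphic supermodules have isomorphic even parts. -/
lemma Isomorphic.evenSubmodule {M N : Supermodule R} (h : Isomorphic M N) :
    Nonempty (M.evenSubmodule ≃ₗ[R.evenSubring] N.evenSubmodule) := by
  obtain ⟨f, hf⟩ := h
  let g : M.evenSubmodule →ₗ[R.evenSubring] N.evenSubmodule :=
    (f.toLinearMap.restrictScalars R.evenSubring).restrict fun x hx => hf 0 x hx
  refine ⟨LinearEquiv.ofBijective g ⟨fun x y hxy => ?_, fun y => ?_⟩⟩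
  · exact Subtype.ext (f.injective (congrArg Subtype.val hxy))
  · obtain ⟨x, hx⟩ := f.surjective y
    refine ⟨⟨evenPart M.grading x, evenPart_mem _ _⟩, Subtype.ext ?_⟩
    change f (evenPart M.grading x) = y
    -- As f preserves parity, f(x₀) is the even part of f(x) = y, which is y itself.
    have h0 := evenPart_of_even N.grading (hf 0 _ (evenPart_mem M.grading x))
    have h1 := evenPart_of_odd N.grading (hf 1 _ (sub_evenPart_mem M.grading x))
    rw [map_sub, map_sub, h0, hx, sub_eq_zero, evenPart_of_even N.grading y.2] at h1
    exact h1.symm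

section OfEquiv

variable (M : Supermodule R) {L : Type*} [AddCommMonoid L] [Module R.evenSubring L]

/-- Contraction of `R ⊗ L` onto `L` along the projection of `R` onto its even part. -/
def evenContract (R : Superring.{u}) (L : Type*) [AddCommMonoid L] [Module R.evenSubring L] :
    R ⊗[R.evenSubring] L →ₗ[R.evenSubring] L :=
  TensorProduct.lift
    { toFun := fun r => LinearMap.lsmul R.evenSubring L ⟨evenPart R.grading r, evenPart_mem _ _⟩
      map_add' := fun r s => by
        rw [← map_add]
        exact congrArg _ (Subtype.ext (map_add _ _ _))
      map_smul' := fun a r => by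
        rw [RingHom.id_apply, ← map_smul]
        exact congrArg _ (Subtype.ext ((unit R).evenPart_even_smul a.2 r)) }

lemma evenContract_tmul (r : R) (l : L) :
    evenContract R L (r ⊗ₜ l) =
      (⟨evenPart R.grading r, evenPart_mem _ _⟩ : R.evenSubring) • l := rfl

lemma evenContract_one_tmul (l : L) : evenContract R L (1 ⊗ₜ l) = l := by
  rw [evenContract_tmul]
  have h : (⟨evenPart R.grading 1, evenPart_mem _ _⟩ : R.evenSubring) = 1 :=
    Subtype.ext (evenPart_of_even _ SetLike.GradedOne.one_mem)
  exact (congrArg (· • l) h).trans (one_smul _ _)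

/-- A supermodule identified with `R ⊗ L`, where `L` is invertible over the even part of `R`
and sits in degree zero, is induced from an invertible module and has even part `L`. -/
lemma isInducedInvertible_of_equiv [hL : Module.Invertible R.evenSubring L]
    (e : R ⊗[R.evenSubring] L ≃ₗ[R] M) (he : ∀ l : L, e (1 ⊗ₜ l) ∈ M.grading 0) :
    M.IsInducedInvertible ∧ Nonempty (L ≃ₗ[R.evenSubring] M.evenSubmodule) := by
  let ι : L →ₗ[R.evenSubring] M.evenSubmodule :=
    { toFun := fun l => ⟨e (1 ⊗ₜ l), he l⟩
      map_add' := fun x y => Subtype.ext (by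
        change e _ = e _ + e _
        rw [TensorProduct.tmul_add, map_add])
      map_smul' := fun a x => Subtype.ext (by
        change e _ = (a : R) • e _
        rw [← map_smul, ← TensorProduct.smul_tmul]
        rfl) }
  have hι : ∀ l, (ι l : M) = e (1 ⊗ₜ l) := fun _ => rfl
  have hsmul : ∀ (r : R) (l : L), r • (ι l : M) = e (r ⊗ₜ l) := fun r l => by
    rw [hι, ← map_smul, TensorProduct.smul_tmul', smul_eq_mul, mul_one]
  -- Contraction along R → R₀ is a left inverse of l ↦ 1 ⊗ l.
  have inj : Function.Injective ι := fun x y hxy => by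
    have h := e.injective (congrArg Subtype.val hxy)
    rw [← evenContract_one_tmul (R := R) x, h, evenContract_one_tmul]
  -- Contraction computes even parts, so the even elements of M all come from L.
  have hev : ∀ z, evenPart M.grading (e z) = ι (evenContract R L z) := by
    intro z
    induction z using TensorProduct.induction_on with
    | zero => simp
    | add x y hx hy => rw [map_add, map_add, map_add, hx, hy, map_add]; rfl
    | tmul r l =>
      rw [← hsmul, M.evenPart_smul_of_even r (ι l).2, evenContract_tmul, map_smul]
      rfl
  have surj : Function.Surjective ι := fun y => by
    obtain ⟨z, hz⟩ := e.surjective y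
    exact ⟨evenContract R L z, Subtype.ext (by rw [← hev, hz, evenPart_of_even _ y.2])⟩
  let ιe := LinearEquiv.ofBijective ι ⟨inj, surj⟩
  refine ⟨⟨Module.Invertible.congr ιe, ?_⟩, ⟨ιe⟩⟩
  have hcomp : ∀ z, M.evenMul (TensorProduct.AlgebraTensorModule.congr (LinearEquiv.refl R R) ιe z)
      = e z := by
    intro z
    induction z using TensorProduct.induction_on with
    | zero => simp
    | add x y hx hy => simp only [map_add, hx, hy]
    | tmul r l => exact hsmul r l
  have hfun : ⇑M.evenMul ∘ ⇑(TensorProduct.AlgebraTensorModule.congr (LinearEquiv.refl R R) ιe) =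
      e := funext hcomp
  rw [← Function.Bijective.of_comp_iff _ (LinearEquiv.bijective
    (TensorProduct.AlgebraTensorModule.congr (LinearEquiv.refl R R) ιe)), hfun]
  exact e.bijective

end OfEquiv

section Induced

variable (R) (L : Type u) [AddCommGroup L] [Module R.evenSubring L]

/-- The supermodule `R ⊗ L` induced from a module over the even part. -/
def induced : Supermodule R where
  carrier := R ⊗[R.evenSubring] L
  grading i := AddSubgroup.closure {t | ∃ r ∈ R.grading i, ∃ l : L, t = r ⊗ₜ l}
  decomposition := parityDecomposition _
    -- The projection of R onto R₀ is R₀-linear, so it can be tensored with L.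
    ((((unit R).evenSubmodule.subtype ∘ₗ (unit R).evenProj).rTensor L).toAddMonoidHom)
    (fun t => by
      induction t using TensorProduct.induction_on with
      | zero => rw [map_zero]; exact zero_mem _
      | add x y hx hy => rw [map_add]; exact add_mem hx hy
      | tmul r l => exact AddSubgroup.subset_closure ⟨_, evenPart_mem _ r, l, rfl⟩)
    (fun t => by
      induction t using TensorProduct.induction_on with
      | zero => rw [map_zero, sub_zero]; exact zero_mem _
      | add x y hx hy => rw [map_add, add_sub_add_comm]; exact add_mem hx hy
      | tmul r l =>
        exact AddSubgroup.subset_closure ⟨_, sub_evenPart_mem R.grading r, l,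
          (TensorProduct.sub_tmul _ _ _).symm⟩)
    (fun t ht => by
      induction ht using AddSubgroup.closure_induction with
      | zero => rw [map_zero]
      | add x y _ _ hx hy => rw [map_add, hx, hy]
      | neg x _ hx => rw [map_neg, hx]
      | mem x hx =>
        obtain ⟨r, hr, l, rfl⟩ := hx
        exact congrArg (· ⊗ₜ[R.evenSubring] l) (evenPart_of_even _ hr))
    (fun t ht => by
      induction ht using AddSubgroup.closure_induction with
      | zero => rw [map_zero]
      | add x y _ _ hx hy => rw [map_add, hx, hy, add_zero]
      | neg x _ hx => rw [map_neg, hx, neg_zero]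
      | mem x hx =>
        obtain ⟨r, hr, l, rfl⟩ := hx
        exact (congrArg (· ⊗ₜ[R.evenSubring] l) (evenPart_of_odd _ hr)).trans
          (TensorProduct.zero_tmul _ _))
  gradedSMul := ⟨by
    intro i k r t hr ht
    rw [vadd_eq_add]
    induction ht using AddSubgroup.closure_induction with
    | zero => rw [smul_zero]; exact zero_mem _
    | add x y _ _ hx hy => rw [smul_add]; exact add_mem hx hy
    | neg x _ hx => rw [smul_neg]; exact neg_mem hx
    | mem x hx =>
      obtain ⟨s, hs, l, rfl⟩ := hx
      exact AddSubgroup.subset_closure ⟨_, SetLike.GradedMul.mul_mem hr hs, l, rfl⟩⟩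

lemma induced_isInducedInvertible [Module.Invertible R.evenSubring L] :
    (induced R L).IsInducedInvertible ∧
      Nonempty (L ≃ₗ[R.evenSubring] (induced R L).evenSubmodule) :=
  (induced R L).isInducedInvertible_of_equiv (LinearEquiv.refl R (R ⊗[R.evenSubring] L)) fun l =>
    AddSubgroup.subset_closure ⟨1, SetLike.GradedOne.one_mem, l, rfl⟩

end Induced

lemma unit_isInducedInvertible (R : Superring.{u}) : (unit R).IsInducedInvertible ∧
    Nonempty (R.evenSubring ≃ₗ[R.evenSubring] (unit R).evenSubmodule) :=
  (unit R).isInducedInvertible_of_equiv (TensorProduct.AlgebraTensorModule.rid R.evenSubring R R)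
    fun l => by
      rw [TensorProduct.AlgebraTensorModule.rid_tmul]
      change (l : R) * 1 ∈ R.grading 0
      rw [mul_one]
      exact l.2

end Supermodule

/-! ### Tensor products of induced supermodules -/

namespace Supermodule

section TensorAlong

variable {R R' : Superring.{u}} (φ : R ⟶ R') (N : Supermodule R') (M : Supermodule R)

/-- The right action of `R` on `N` through `φ`, `n · r = (-1)^{|n||r|} φ(r) n`. -/
def rightAct : N →+ R →+ N :=
  -- An odd scalar sees n with the sign of its odd part reversed; this extends the sign rule
  -- additively to inhomogeneous elements.
  AddMonoidHom.mk' (fun n => AddMonoidHom.mk' (fun r => φ.toRingHom (evenPart R.grading r) • n +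
      φ.toRingHom (r - evenPart R.grading r) • (evenPart N.grading n - (n - evenPart N.grading n)))
    (fun r s => by
      simp only [map_add, add_sub_add_comm, add_smul]
      abel))
    (fun m n => by
      ext r
      simp only [AddMonoidHom.mk'_apply, map_add, smul_add, AddMonoidHom.add_apply, smul_sub]
      abel)

lemma rightAct_apply (n : N) (r : R) : rightAct φ N n r =
    φ.toRingHom (evenPart R.grading r) • n +
      φ.toRingHom (r - evenPart R.grading r) • (evenPart N.grading n - (n - evenPart N.grading n)) :=
  rfl

lemma rightAct_of_mem {i j : ZMod 2} {n : N} (hn : n ∈ N.grading i) {r : R}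
    (hr : r ∈ R.grading j) :
    rightAct φ N n r = ((-1 : ℤ) ^ (i.val * j.val)) • (φ.toRingHom r • n) := by
  rw [rightAct_apply]
  rcases parity_cases i with rfl | rfl <;> rcases parity_cases j with rfl | rfl <;>
    simp [evenPart_of_even, evenPart_of_odd, hn, hr, ZMod.val_one]

lemma rightAct_mem {i j : ZMod 2} {n : N} (hn : n ∈ N.grading i) {r : R}
    (hr : r ∈ R.grading j) : rightAct φ N n r ∈ N.grading (i + j) := by
  rw [rightAct_of_mem φ N hn hr, add_comm]
  exact zsmul_mem (N.smul_mem_grading (φ.map_mem j r hr) hn) _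

lemma rightAct_one (n : N) : rightAct φ N n 1 = n := by
  rw [rightAct_apply, evenPart_of_even R.grading SetLike.GradedOne.one_mem]
  simp

/-- Moving φ(r) past s costs (-1)^{|r||s|}, exactly the extra sign caused by the degree of s in s·n.
-/
lemma rightAct_smul (s : R') (n : N) (r : R) :
    rightAct φ N (s • n) r = s • rightAct φ N n r := by
  induction s using DirectSum.Decomposition.inductionOn R'.grading with
  | zero => simp
  | add a b ha hb => rw [add_smul, add_smul, map_add, AddMonoidHom.add_apply, ha, hb]
  | @homogeneous k s =>
  induction n using DirectSum.Decomposition.inductionOn N.grading with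
  | zero => simp
  | add a b ha hb => simp only [smul_add, map_add, AddMonoidHom.add_apply, ha, hb]
  | @homogeneous i n =>
  induction r using DirectSum.Decomposition.inductionOn R.grading with
  | zero => simp
  | add a b ha hb => rw [map_add, map_add, smul_add, ha, hb]
  | @homogeneous j r =>
    rw [rightAct_of_mem φ N (N.smul_mem_grading s.2 n.2) r.2, rightAct_of_mem φ N n.2 r.2,
      smul_smul, R'.supercomm j k _ _ (φ.map_mem j r r.2) s.2]
    rcases parity_cases i with rfl | rfl <;> rcases parity_cases j with rfl | rfl <;>
      rcases parity_cases k with rfl | rfl <;> simp [ZMod.val_one, mul_smul, CharTwo.add_self_eq_zero]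

lemma rightAct_mul (n : N) (r s : R) :
    rightAct φ N n (r * s) = rightAct φ N (rightAct φ N n r) s := by
  induction n using DirectSum.Decomposition.inductionOn N.grading with
  | zero => simp
  | add a b ha hb => simp only [map_add, AddMonoidHom.add_apply, ha, hb]
  | @homogeneous i n =>
  induction r using DirectSum.Decomposition.inductionOn R.grading with
  | zero => simp
  | add a b ha hb => simp only [add_mul, map_add, AddMonoidHom.add_apply, ha, hb]
  | @homogeneous j r =>
  induction s using DirectSum.Decomposition.inductionOn R.grading with
  | zero => simp
  | add a b ha hb => simp only [mul_add, map_add, ha, hb]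
  | @homogeneous k s =>
    rw [rightAct_of_mem φ N (rightAct_mem φ N n.2 r.2) s.2, rightAct_of_mem φ N n.2 r.2,
      rightAct_of_mem φ N n.2 (SetLike.GradedMul.mul_mem r.2 s.2), R.supercomm j k r s r.2 s.2]
    rcases parity_cases i with rfl | rfl <;> rcases parity_cases j with rfl | rfl <;>
      rcases parity_cases k with rfl | rfl <;> simp [ZMod.val_one, mul_smul, CharTwo.add_self_eq_zero]

/-- The defining relations concern homogeneous elements only; biadditivity of the right action
extends them to all elements. -/
lemma tensorMk_smul (n : N) (r : R) (m : M) :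
    tensorMk φ N M n (r • m) = tensorMk φ N M (rightAct φ N n r) m := by
  induction n using DirectSum.Decomposition.inductionOn N.grading with
  | zero => simp [tensorMk]
  | add a b ha hb =>
    simp only [tensorMk, TensorProduct.add_tmul, Submodule.Quotient.mk_add, map_add,
      AddMonoidHom.add_apply] at ha hb ⊢
    rw [ha, hb]
  | @homogeneous i n =>
  induction r using DirectSum.Decomposition.inductionOn R.grading with
  | zero => simp [tensorMk]
  | add a b ha hb =>
    simp only [tensorMk, add_smul, TensorProduct.add_tmul, TensorProduct.tmul_add,
      Submodule.Quotient.mk_add, map_add] at ha hb ⊢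
    rw [ha, hb]
  | @homogeneous j r =>
  induction m using DirectSum.Decomposition.inductionOn M.grading with
  | zero => simp [tensorMk]
  | add a b ha hb =>
    simp only [tensorMk, smul_add, TensorProduct.tmul_add, Submodule.Quotient.mk_add] at ha hb ⊢
    rw [ha, hb]
  | @homogeneous k m =>
    rw [rightAct_of_mem φ N n.2 r.2]
    refine ((Submodule.Quotient.eq _).mpr (Submodule.subset_span ?_)).symm
    exact ⟨i, j, k, n, n.2, r, r.2, m, m.2, rfl⟩

variable [Algebra R.evenSubring R'] [Module R.evenSubring N] [IsScalarTower R.evenSubring R' N]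

/-- The right action is linear over the even part. -/
def rightActLinear (hφ : ∀ a : R.evenSubring, algebraMap R.evenSubring R' a = φ.toRingHom a)
    (n : N) : R →ₗ[R.evenSubring] N where
  toFun := rightAct φ N n
  map_add' := map_add _
  map_smul' a r := by
    have h : evenPart R.grading (a • r) = a * evenPart R.grading r :=
      (unit R).evenPart_even_smul a.2 r
    rw [RingHom.id_apply, ← algebraMap_smul R' a (rightAct φ N n r), hφ, rightAct_apply,
      rightAct_apply, h, Subring.smul_def, smul_eq_mul, ← mul_sub, map_mul, map_mul, mul_smul,
      mul_smul, smul_add]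

/-- The comparison map `N ⊗_{R₀} M₀ → N ⊗_R M`. -/
def tensorEvenTo (hφ : ∀ a : R.evenSubring, algebraMap R.evenSubring R' a = φ.toRingHom a) :
    N ⊗[R.evenSubring] M.evenSubmodule →ₗ[R'] TensorCarrier φ N M :=
  let f : N ⊗[R.evenSubring] M.evenSubmodule →+ TensorCarrier φ N M :=
    TensorProduct.liftAddHom
      (AddMonoidHom.mk' (fun n => AddMonoidHom.mk' (fun m => tensorMk φ N M n m)
        (fun x y => by
          simp [tensorMk, TensorProduct.tmul_add]))
        (fun x y => by
          ext m
          simp [tensorMk, TensorProduct.add_tmul]))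
      (fun a n m => by
        change tensorMk φ N M (a • n) m = tensorMk φ N M n ((a : R) • (m : M))
        rw [tensorMk_smul, rightAct_apply, evenPart_of_even R.grading a.2, sub_self, map_zero,
          zero_smul, add_zero, ← hφ, algebraMap_smul])
  { f with
    map_smul' := fun r t => by
      change f (r • t) = r • f t
      induction t using TensorProduct.induction_on with
      | zero => simp
      | add x y hx hy => rw [smul_add, map_add, map_add, hx, hy, smul_add]
      | tmul n m => rfl }

lemma tensorEvenTo_tmul
    (hφ : ∀ a : R.evenSubring, algebraMap R.evenSubring R' a = φ.toRingHom a)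
    (n : N) (m : M.evenSubmodule) :
    tensorEvenTo φ N M hφ (n ⊗ₜ m) = tensorMk φ N M n m := rfl

/-- Elements of M are sums of rm with m even, and n ⊗ rm = (n·r) ⊗ m. -/
lemma tensorEvenTo_surjective
    (hφ : ∀ a : R.evenSubring, algebraMap R.evenSubring R' a = φ.toRingHom a)
    (hM : Function.Surjective M.evenMul) : Function.Surjective (tensorEvenTo φ N M hφ) := by
  intro t
  obtain ⟨t, rfl⟩ := Submodule.Quotient.mk_surjective _ t
  change _ ∈ LinearMap.range (tensorEvenTo φ N M hφ)
  induction t using TensorProduct.induction_on with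
  | zero => exact zero_mem _
  | add x y hx hy => exact add_mem hx hy
  | tmul n m =>
    obtain ⟨z, rfl⟩ := hM m
    induction z using TensorProduct.induction_on with
    | zero => rw [map_zero, TensorProduct.tmul_zero]; exact zero_mem _
    | add x y hx hy => rw [map_add, TensorProduct.tmul_add]; exact add_mem hx hy
    | tmul r m =>
      refine ⟨rightAct φ N n r ⊗ₜ m, ?_⟩
      rw [tensorEvenTo_tmul, ← tensorMk_smul]
      rfl

/-- A left inverse is obtained by writing an element of M in R ⊗ M₀ and letting its R-factors act on
n from the right. -/
lemma tensorEvenTo_injective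
    (hφ : ∀ a : R.evenSubring, algebraMap R.evenSubring R' a = φ.toRingHom a)
    (hM : Function.Bijective M.evenMul) : Function.Injective (tensorEvenTo φ N M hφ) := by
  let μ := LinearEquiv.ofBijective _ hM
  let T : N → R ⊗[R.evenSubring] M.evenSubmodule →ₗ[R.evenSubring]
    N ⊗[R.evenSubring] M.evenSubmodule := fun n => (rightActLinear φ N hφ n).rTensor _
  have hT : ∀ n r m, T n (r ⊗ₜ m) = rightAct φ N n r ⊗ₜ m := fun _ _ _ => rfl
  have hTadd : ∀ n n' z, T (n + n') z = T n z + T n' z := by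
    intro n n' z
    induction z using TensorProduct.induction_on with
    | zero => simp
    | add x y hx hy => rw [map_add, hx, hy, map_add, map_add]; abel
    | tmul r m => rw [hT, hT, hT, map_add, AddMonoidHom.add_apply, TensorProduct.add_tmul]
  have hTsmul : ∀ (s : R') n z, T (s • n) z = s • T n z := by
    intro s n z
    induction z using TensorProduct.induction_on with
    | zero => simp
    | add x y hx hy => rw [map_add, hx, hy, map_add, smul_add]
    | tmul r m => rw [hT, hT, rightAct_smul, TensorProduct.smul_tmul']
  have hTact : ∀ n (r : R) z, T n (r • z) = T (rightAct φ N n r) z := by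
    intro n r z
    induction z using TensorProduct.induction_on with
    | zero => simp
    | add x y hx hy => rw [smul_add, map_add, hx, hy, map_add]
    | tmul a m => rw [TensorProduct.smul_tmul', smul_eq_mul, hT, hT, rightAct_mul]
  let β : N ⊗[ℤ] M →ₗ[R'] N ⊗[R.evenSubring] M.evenSubmodule :=
    TensorProduct.AlgebraTensorModule.lift
      { toFun := fun n => ((T n).toAddMonoidHom.comp μ.symm.toAddEquiv.toAddMonoidHom).toIntLinearMap
        map_add' := fun n n' => by ext m; exact hTadd n n' _
        map_smul' := fun s n => by ext m; exact hTsmul s n _ }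
  have hβ : ∀ n m, β (n ⊗ₜ m) = T n (μ.symm m) := fun _ _ => rfl
  -- The relations are killed because acting by r on the R ⊗ M₀ side equals acting by r on n, which
  -- is `hTact`.
  let γ : TensorCarrier φ N M →ₗ[R'] N ⊗[R.evenSubring] M.evenSubmodule :=
    (Submodule.span R' (tensorRelations φ N M)).liftQ β (by
      rw [Submodule.span_le]
      rintro _ ⟨i, j, k, n, hn, r, hr, m, hm, rfl⟩
      rw [SetLike.mem_coe, LinearMap.mem_ker, map_sub, hβ, hβ, map_smul, hTact,
        rightAct_of_mem φ N hn hr, sub_self])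
  refine Function.LeftInverse.injective (g := γ) fun t => ?_
  induction t using TensorProduct.induction_on with
  | zero => simp
  | add x y hx hy => rw [map_add, map_add, hx, hy]
  | tmul n m =>
    change T n (μ.symm m) = _
    have h : μ.symm (m : M) = 1 ⊗ₜ m := by
      rw [LinearEquiv.symm_apply_eq]
      exact (one_smul R (m : M)).symm
    rw [h, hT, rightAct_one]

end TensorAlong

/-- Tensor products of induced invertible supermodules are induced from the tensor product of the
even parts. -/
lemma tensorAlong_isInducedInvertible {R R' : Superring.{u}} (φ : R ⟶ R') (N : Supermodule R')
    (M : Supermodule R) [Algebra R.evenSubring R'.evenSubring] [Algebra R.evenSubring R']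
    [IsScalarTower R.evenSubring R'.evenSubring R'] [Module R.evenSubring N]
    [IsScalarTower R.evenSubring R' N] [IsScalarTower R.evenSubring R'.evenSubring N]
    (hφ : ∀ a : R.evenSubring, algebraMap R.evenSubring R' a = φ.toRingHom a)
    (hN : N.IsInducedInvertible) (hM : M.IsInducedInvertible) :
    (tensorAlong φ N M).IsInducedInvertible ∧
      Nonempty (N.evenSubmodule ⊗[R.evenSubring] M.evenSubmodule ≃ₗ[R'.evenSubring]
        (tensorAlong φ N M).evenSubmodule) := by
  have := hN.invertible
  have := hM.invertible
  -- Substitute N = R' ⊗ N₀ into N ⊗_{R₀} M₀ and reassociate.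
  let e : R' ⊗[R'.evenSubring] (N.evenSubmodule ⊗[R.evenSubring] M.evenSubmodule) ≃ₗ[R']
      tensorAlong φ N M :=
    (TensorProduct.AlgebraTensorModule.assoc R.evenSubring R'.evenSubring R' R' N.evenSubmodule
      M.evenSubmodule).symm ≪≫ₗ
    TensorProduct.AlgebraTensorModule.congr (LinearEquiv.ofBijective _ hN.bijective)
      (LinearEquiv.refl R.evenSubring M.evenSubmodule) ≪≫ₗ
    LinearEquiv.ofBijective (tensorEvenTo φ N M hφ) ⟨tensorEvenTo_injective φ N M hφ hM.bijective,
      tensorEvenTo_surjective φ N M hφ hM.bijective.2⟩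
  refine (tensorAlong φ N M).isInducedInvertible_of_equiv e fun l => ?_
  induction l using TensorProduct.induction_on with
  | zero => rw [TensorProduct.tmul_zero, map_zero]; exact zero_mem _
  | add x y hx hy => rw [TensorProduct.tmul_add, map_add]; exact add_mem hx hy
  | tmul n m =>
    have h : e (1 ⊗ₜ (n ⊗ₜ m)) = tensorMk φ N M ((1 : R') • (n : N)) m := rfl
    rw [h, one_smul]
    exact tensorMk_mem φ N M (add_zero 0) n.2 m.2

end Supermodule

/-- The map induced on even parts by a morphism of superrings. -/
def Superring.Hom.evenMap {R R' : Superring.{u}} (φ : R ⟶ R') :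
    R.evenSubring →+* R'.evenSubring :=
  φ.toRingHom.restrict _ _ fun x hx => φ.map_mem 0 x hx

/-! ### Classes in the Picard group of the even part -/

namespace Supermodule

lemma tensor_isInducedInvertible {R : Superring.{u}} {M N : Supermodule R}
    (hM : M.IsInducedInvertible) (hN : N.IsInducedInvertible) :
    (M.tensor N).IsInducedInvertible ∧
      Nonempty (M.evenSubmodule ⊗[R.evenSubring] N.evenSubmodule ≃ₗ[R.evenSubring]
        (M.tensor N).evenSubmodule) :=
  tensorAlong_isInducedInvertible (𝟙 R) M N (fun _ => rfl) hM hN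

lemma baseChange_isInducedInvertible {R R' : Superring.{u}} (φ : R ⟶ R') {M : Supermodule R}
    (hM : M.IsInducedInvertible) :
    letI := (Superring.Hom.evenMap φ).toAlgebra
    (M.baseChange φ).IsInducedInvertible ∧
      Nonempty (R'.evenSubring ⊗[R.evenSubring] M.evenSubmodule ≃ₗ[R'.evenSubring]
        (M.baseChange φ).evenSubmodule) := by
  let := (Superring.Hom.evenMap φ).toAlgebra
  let : Algebra R.evenSubring R' := Algebra.compHom R' (Superring.Hom.evenMap φ)
  have : IsScalarTower R.evenSubring R'.evenSubring R' := .of_algebraMap_eq fun _ => rfl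
  obtain ⟨h, ⟨e⟩⟩ := tensorAlong_isInducedInvertible φ (unit R') M (fun _ => rfl)
    (unit_isInducedInvertible R').1 hM
  obtain ⟨u⟩ := (unit_isInducedInvertible R').2
  exact ⟨h, ⟨TensorProduct.AlgebraTensorModule.congr u
    (LinearEquiv.refl R.evenSubring M.evenSubmodule) ≪≫ₗ e⟩⟩

/-- The class in the Picard group of the even part. -/
noncomputable def evenClass {R : Superring.{u}} (M : Supermodule R) (hM : M.IsInducedInvertible) :
    CommRing.Pic R.evenSubring :=
  haveI := hM.invertible
  CommRing.Pic.mk R.evenSubring M.evenSubmodule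

/-- An isomorphism restricts to even parts, and an isomorphism of even parts extends R-linearly to
the induced modules. -/
lemma evenClass_eq_iff {R : Superring.{u}} {M N : Supermodule R} (hM : M.IsInducedInvertible)
    (hN : N.IsInducedInvertible) : M.evenClass hM = N.evenClass hN ↔ Isomorphic M N := by
  have := hM.invertible
  have := hN.invertible
  rw [evenClass, evenClass, CommRing.Pic.mk_eq_mk_iff]
  exact ⟨fun ⟨e⟩ => isomorphic_of_evenSubmodule hM hN e, fun h => h.evenSubmodule⟩

lemma evenClass_tensor {R : Superring.{u}} {M N : Supermodule R} (hM : M.IsInducedInvertible)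
    (hN : N.IsInducedInvertible) :
    (M.tensor N).evenClass (tensor_isInducedInvertible hM hN).1 =
      M.evenClass hM * N.evenClass hN := by
  have := hM.invertible
  have := hN.invertible
  obtain ⟨h, ⟨e⟩⟩ := tensor_isInducedInvertible hM hN
  have := h.invertible
  rw [evenClass, evenClass, evenClass, ← CommRing.Pic.mk_tensor, CommRing.Pic.mk_eq_mk_iff]
  exact ⟨e.symm⟩

lemma evenClass_unit (R : Superring.{u}) :
    (unit R).evenClass (unit_isInducedInvertible R).1 = 1 := by
  obtain ⟨h, ⟨e⟩⟩ := unit_isInducedInvertible R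
  have := h.invertible
  rw [evenClass, CommRing.Pic.mk_eq_one_iff]
  exact ⟨e.symm⟩

lemma evenClass_baseChange {R R' : Superring.{u}} (φ : R ⟶ R') {M : Supermodule R}
    (hM : M.IsInducedInvertible) :
    (M.baseChange φ).evenClass (baseChange_isInducedInvertible φ hM).1 =
      CommRing.Pic.mapRingHom (Superring.Hom.evenMap φ) (M.evenClass hM) := by
  have := hM.invertible
  let := (Superring.Hom.evenMap φ).toAlgebra
  obtain ⟨h, ⟨e⟩⟩ := baseChange_isInducedInvertible φ hM
  have := h.invertible
  rw [evenClass, evenClass, CommRing.Pic.mapRingHom, CommRing.Pic.mapAlgebra_apply,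
    CommRing.Pic.mk_eq_mk_iff]
  exact ⟨e.symm ≪≫ₗ TensorProduct.AlgebraTensorModule.congr (LinearEquiv.refl _ _)
    (CommRing.Pic.mk.linearEquiv R.evenSubring M.evenSubmodule).symm⟩

end Supermodule

/-! ### The Picard functor and its splitting -/

/-- `Pic₊(R)` is the Picard group of the even part of `R`. -/
noncomputable def PicPlus.equivPic (R : NoetherianSuperring.{u}) :
    PicPlus R.toSuperring ≃ CommRing.Pic R.toSuperring.evenSubring :=
  Equiv.ofBijective
    (Quotient.lift
      (fun M => M.1.evenClass ((Supermodule.isInvertible_iff R.isNoetherian M.1).mp M.2))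
      fun _ _ h => (Supermodule.evenClass_eq_iff _ _).mpr h)
    ⟨by
      rintro ⟨M⟩ ⟨N⟩ h
      exact Quotient.sound ((Supermodule.evenClass_eq_iff _ _).mp h), by
      intro L
      -- The class of L is attained by R ⊗ L, whose even part is L.
      obtain ⟨h, ⟨e⟩⟩ := Supermodule.induced_isInducedInvertible R.toSuperring L
      have := h.invertible
      refine ⟨PicPlus.mk _ ((Supermodule.isInvertible_iff R.isNoetherian _).mpr h), ?_⟩
      exact CommRing.Pic.mk_eq_iff.mpr ⟨e.symm⟩⟩

/-- `Pic₊` as a functor from Noetherian superrings to abelian groups. -/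
noncomputable def picPlusFunctor : NoetherianSuperring.{u} ⥤ CommGrpCat.{u + 1} where
  obj R := CommGrpCat.of (ULift.{u + 1} (CommRing.Pic R.toSuperring.evenSubring))
  map φ := CommGrpCat.ofHom (MulEquiv.ulift.symm.toMonoidHom.comp
    ((CommRing.Pic.mapRingHom (Superring.Hom.evenMap φ)).comp MulEquiv.ulift.toMonoidHom))
  map_id R := by
    ext x
    exact CommRing.Pic.mapRingHom_id_apply (M := x.down)
  map_comp φ ψ := by
    ext x
    exact (CommRing.Pic.mapRingHom_mapRingHom (M := x.down)
      (f := Superring.Hom.evenMap φ) (g := Superring.Hom.evenMap ψ)).symm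

/-- A section of a homomorphism of abelian groups splits off its kernel. -/
lemma exists_mulEquiv_prod_ker {G H : Type*} [CommGroup G] [CommGroup H] (f : G →* H)
    (s : H →* G) (h : ∀ y, f (s y) = y) :
    ∃ e : G ≃* H × f.ker, (∀ x, (e x).1 = f x) ∧ ∀ k : f.ker, e k = (1, k) := by
  refine ⟨{
    -- The kernel component is x with its image under s ∘ f divided out.
    toFun := fun x => (f x, ⟨x * (s (f x))⁻¹, by simp [MonoidHom.mem_ker, h]⟩)
    invFun := fun y => s y.1 * y.2
    left_inv := fun x => by simp
    right_inv := fun y => ?_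
    map_mul' := fun x y => ?_ }, fun _ => rfl, fun k => ?_⟩
  · obtain ⟨y, k, hk⟩ := y
    rw [MonoidHom.mem_ker] at hk
    exact Prod.ext (by simp [h, hk]) (Subtype.ext (by simp [h, hk]))
  · exact Prod.ext (map_mul f x y) (Subtype.ext (by
      simp only [map_mul, mul_inv, Subgroup.coe_mul, Prod.snd_mul]
      exact mul_mul_mul_comm _ _ _ _))
  · have hk : f k = 1 := k.2
    exact Prod.ext hk (Subtype.ext (by simp [hk]))

/-- The ring map σ preserves parity because its values are even and the odd part of R̄ is zero. -/
lemma NoetherianSuperring.exists_section_proj (R : NoetherianSuperring.{u})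
    (h : R.toSuperring.IsSplit) : ∃ s : R.superreduced h ⟶ R, s ≫ R.proj h = 𝟙 _ := by
  obtain ⟨σ, h0, hσ⟩ := id h
  refine ⟨⟨σ, fun i x hx => ?_⟩, ?_⟩
  · rcases parity_cases i with rfl | rfl
    · exact h0 x
    · have hx : x = 0 := hx
      rw [hx, map_zero]
      exact zero_mem _
  · have ext : ∀ f g : R.superreduced h ⟶ R.superreduced h, f.toRingHom = g.toRingHom → f = g := by
      rintro ⟨f, _⟩ ⟨g, _⟩ rfl
      rfl
    exact ext _ _ (RingHom.ext hσ)

theorem mainTheorem10 :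
    ∃ (Pic : NoetherianSuperring.{u} ⥤ CommGrpCat.{u + 1})
      (cl : ∀ R : NoetherianSuperring.{u}, PicPlus R.toSuperring ≃ Pic.obj R),
      -- the product is `[M] * [N] = [M ⊗ N]`
      (∀ (R : NoetherianSuperring.{u}) (M N : Supermodule R.toSuperring)
        (hM : M.IsInvertible) (hN : N.IsInvertible), ∃ hMN : (M.tensor N).IsInvertible,
          cl R (PicPlus.mk M hM) * cl R (PicPlus.mk N hN) = cl R (PicPlus.mk (M.tensor N) hMN)) ∧
      -- the identity is `[R]`
      (∀ R : NoetherianSuperring.{u}, ∃ h : (Supermodule.unit R.toSuperring).IsInvertible,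
          cl R (PicPlus.mk (Supermodule.unit R.toSuperring) h) = 1) ∧
      -- the map induced by `φ` is extension of scalars
      (∀ (R R' : NoetherianSuperring.{u}) (φ : R ⟶ R') (M : Supermodule R.toSuperring)
        (hM : M.IsInvertible), ∃ hM' : (M.baseChange φ).IsInvertible,
          (Pic.map φ).hom (cl R (PicPlus.mk M hM)) = cl R' (PicPlus.mk (M.baseChange φ) hM')) ∧
      -- the splitting for split superrings
      (∀ (R : NoetherianSuperring.{u}) (h : R.toSuperring.IsSplit),
        Function.Surjective (Pic.map (R.proj h)).hom ∧
        ∃ e : Pic.obj R ≃* Pic.obj (R.superreduced h) × (Pic.map (R.proj h)).hom.ker,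
          (∀ x, (e x).1 = (Pic.map (R.proj h)).hom x) ∧
          ∀ k : (Pic.map (R.proj h)).hom.ker, e k = (1, k)) := by
  -- The bijection `cl` sends [M] to [M₀], so each clause becomes a statement about even parts.
  refine ⟨picPlusFunctor, fun R => (PicPlus.equivPic R).trans Equiv.ulift.symm, ?_, ?_, ?_, ?_⟩
  · intro R M N hM hN
    have hM' := (Supermodule.isInvertible_iff R.isNoetherian M).mp hM
    have hN' := (Supermodule.isInvertible_iff R.isNoetherian N).mp hN
    exact ⟨(Supermodule.isInvertible_iff R.isNoetherian _).mpr
      (Supermodule.tensor_isInducedInvertible hM' hN').1,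
      congrArg ULift.up (Supermodule.evenClass_tensor hM' hN').symm⟩
  · intro R
    exact ⟨(Supermodule.isInvertible_iff R.isNoetherian _).mpr
      (Supermodule.unit_isInducedInvertible _).1,
      congrArg ULift.up (Supermodule.evenClass_unit R.toSuperring)⟩
  · intro R R' φ M hM
    have hM' := (Supermodule.isInvertible_iff R.isNoetherian M).mp hM
    exact ⟨(Supermodule.isInvertible_iff R'.isNoetherian _).mpr
      (Supermodule.baseChange_isInducedInvertible φ hM').1,
      congrArg ULift.up (Supermodule.evenClass_baseChange φ hM').symm⟩
  · intro R h
    obtain ⟨s, hs⟩ := R.exists_section_proj h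
    -- Functoriality turns the section of π_R into a section of the induced homomorphism.
    have hsec : ∀ y, (picPlusFunctor.map (R.proj h)).hom ((picPlusFunctor.map s).hom y) = y := by
      intro y
      rw [← CommGrpCat.comp_apply, ← Functor.map_comp, hs, CategoryTheory.Functor.map_id]
      rfl
    exact ⟨fun y => ⟨_, hsec y⟩, exists_mulEquiv_prod_ker _ (picPlusFunctor.map s).hom hsec⟩
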